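/- **Theorem 2 (Second order of accuracy).** Let $\alpha\in(0,2)$, $\Omega=(a_1,b_1)\times(a_2,b_2)\subset\mathbb R^2$ with $a_1<b_1$, $a_2<b_2$, and $L=\max\{b_1-a_1,\,b_2-a_2\}$. For $u:\mathbb R^2\to\mathbb R$ let $$(-\Delta)^{\alpha/2}u(\mathbf x)=c_{2,\alpha}\,\mathrm{P.V.}\!\int_{\mathbb R^2}\frac{u(\mathbf x)-u(\mathbf x')}{|\mathbf x-\mathbf x'|^{2+\alpha}}\,d\mathbf x',\qquad c_{2,\alpha}=\frac{2^{\alpha-1}\alpha\,\Gamma\big((2+\alpha)/2\big)}{\pi\,\Gamma(1-\alpha/2)} .$$ For an integer $N\ge1$ put $h=L/N$, $\xi_{ij}=(ih,jh)$ and $I_{ij}=[ih,(i+1)h]\times[jh,(j+1)h]$. For $\mathbf x=(x,y)$ and $\xi=(\xi_1,\xi_2)\neq0$ put $$\psi_2(\mathbf x,\xi)=\frac1{|\xi|^2}\Big(\sum_{m,n=0,1}u\big(x+(-1)^m\xi_1,\,y+(-1)^n\xi_2\big)-4u(\mathbf x)\Big).$$ The finite difference approximation with splitting parameter $\gamma=2$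 is, for $\mathbf x\in\Omega$, $$(-\Delta)^{\alpha/2}_{h,2}u(\mathbf x)=-c_{2,\alpha}\bigg(\sum_{i,j=0}^{N-1}Q_{ij}(\mathbf x)\int_{I_{ij}}|\xi|^{-\alpha}\,d\xi-4u(\mathbf x)\int_{D_2}|\xi|^{-(2+\alpha)}\,d\xi\bigg),$$ where $D_2=(0,\infty)^2\setminus(0,L)^2$, $Q_{00}(\mathbf x)=\tfrac12\big(\psi_2(\mathbf x,\xi_{10})+\psi_2(\mathbf x,\xi_{01})\big)$, and $Q_{ij}(\mathbf x)=\tfrac14\sum_{m,n=0,1}\psi_2(\mathbf x,\xi_{(i+m)(j+n)})$ for $(i,j)\ne(0,0)$. Let $0<\varepsilon\le1+\lfloor\alpha\rfloor-\alpha$, and suppose that $u$ vanishes outside $\Omega$ and that $u\in C^{2+\lfloor\alpha\rfloor,\,\alpha-\lfloor\alpha\rfloor+\varepsilon}(\mathbb R^2)$, i.e. $u$ has continuous partial derivatives up to order $2+\lfloor\alpha\rfloor$, and those of order $2+\lfloor\alpha\rfloor$ are uniformly Hölder continuous with exponent $\alpha-\lfloor\alpha\rfloor+\varepsilon$. Then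 the principal value $(-\Delta)^{\alpha/2}u(\mathbf x)$ exists for every $\mathbf x\in\Omega$, and there is a constant $C>0$ independent of $h$ (that is, of $N$) such that for all $N\ge1$ $$\sup_{\mathbf x\in\Omega}\Big|(-\Delta)^{\alpha/2}u(\mathbf x)-(-\Delta)^{\alpha/2}_{h,2}u(\mathbf x)\Big|\le C\,h^2 .$$ -/

import Mathlib

open MeasureTheory Filter Topology Set

noncomputable section

/-- The class `C^{k,s}(ℝ^d)`: the partial derivatives of `u` of order at most `k` exist and are
continuous, and those of order `k` (the components of the `k`-th derivative) are uniformly Hölder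
continuous with exponent `s` on the whole space. -/
def IsHolderClass {d : ℕ} (k : ℕ) (s : ℝ) (u : EuclideanSpace ℝ (Fin d) → ℝ) : Prop :=
  ContDiff ℝ k u ∧
    ∃ K : ℝ, ∀ x y : EuclideanSpace ℝ (Fin d),
      ‖iteratedFDeriv ℝ k u x - iteratedFDeriv ℝ k u y‖ ≤ K * ‖x - y‖ ^ s

/-- The normalization constant `c_{d,α}` of the integral fractional Laplacian. -/
def fracConst (d : ℕ) (α : ℝ) : ℝ :=
  2 ^ (α - 1) * α * Real.Gamma ((d + α) / 2) /
    (Real.sqrt (Real.pi ^ d) * Real.Gamma (1 - α / 2))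

/-- The integrand `(u(x) - u(x')) / |x - x'|^{d+α}` as a function of `x'`. -/
def fracIntegrand {d : ℕ} (α : ℝ) (u : EuclideanSpace ℝ (Fin d) → ℝ)
    (x x' : EuclideanSpace ℝ (Fin d)) : ℝ :=
  (u x - u x') / ‖x - x'‖ ^ ((d : ℝ) + α)

/-- The hypersingular integral with the ball of radius `r` about `x` cut out. -/
def fracLaplacianTrunc {d : ℕ} (α : ℝ) (u : EuclideanSpace ℝ (Fin d) → ℝ)
    (x : EuclideanSpace ℝ (Fin d)) (r : ℝ) : ℝ :=
  fracConst d α * ∫ x' in (Metric.ball x r)ᶜ, fracIntegrand α u x x'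

/-- The integral fractional Laplacian `(-Δ)^{α/2} u(x)`, as a Cauchy principal value. It is
meaningful where `FracLaplacianExists` holds. -/
def fracLaplacian {d : ℕ} (α : ℝ) (u : EuclideanSpace ℝ (Fin d) → ℝ)
    (x : EuclideanSpace ℝ (Fin d)) : ℝ :=
  limUnder (𝓝[>] (0 : ℝ)) (fracLaplacianTrunc α u x)

/-- The principal value that defines `(-Δ)^{α/2} u(x)` exists: the truncated integrals converge
absolutely, and they tend to a finite limit (necessarily `fracLaplacian α u x`) as the radius
tends to `0`. -/
def FracLaplacianExists {d : ℕ} (α : ℝ) (u : EuclideanSpace ℝ (Fin d) → ℝ)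
    (x : EuclideanSpace ℝ (Fin d)) : Prop :=
  (∀ r : ℝ, 0 < r → IntegrableOn (fracIntegrand α u x) (Metric.ball x r)ᶜ) ∧
    Tendsto (fracLaplacianTrunc α u x) (𝓝[>] 0) (𝓝 (fracLaplacian α u x))

/-- The open rectangle `Ω = (a₁, b₁) × (a₂, b₂)`. -/
def rectDomain (a₁ b₁ a₂ b₂ : ℝ) : Set (EuclideanSpace ℝ (Fin 2)) :=
  {x | x 0 ∈ Ioo a₁ b₁ ∧ x 1 ∈ Ioo a₂ b₂}

/-- The central difference quotient
`ψ_γ(x, ξ) = |ξ|^{-γ} (∑_{m,n=0,1} u(x + (-1)^m ξ, y + (-1)^n η) - 4 u(x))`. -/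
def centralQuot (γ : ℝ) (u : EuclideanSpace ℝ (Fin 2) → ℝ) (x ξ : EuclideanSpace ℝ (Fin 2)) : ℝ :=
  (∑ m ∈ Finset.range 2, ∑ n ∈ Finset.range 2,
      u !₂[x 0 + (-1) ^ m * ξ 0, x 1 + (-1) ^ n * ξ 1] - 4 * u x) / ‖ξ‖ ^ γ

/-- The weight `ω_γ(ξ) = |ξ|^{γ - (2+α)}`. -/
def quadWeight (γ α : ℝ) (ξ : EuclideanSpace ℝ (Fin 2)) : ℝ :=
  ‖ξ‖ ^ (γ - (2 + α))

/-- The grid point `ξ_{ij} = (i h, j h)`. -/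
def gridPoint (h : ℝ) (i j : ℕ) : EuclideanSpace ℝ (Fin 2) :=
  !₂[i * h, j * h]

/-- The element `I_{ij} = [i h, (i+1) h] × [j h, (j+1) h]`. -/
def gridElement (h : ℝ) (i j : ℕ) : Set (EuclideanSpace ℝ (Fin 2)) :=
  {ξ | ξ 0 ∈ Icc (i * h) ((i + 1) * h) ∧ ξ 1 ∈ Icc (j * h) ((j + 1) * h)}

/-- The far region `D₂`: the open first quadrant without the square `D₁ = (0, L)²`. -/
def farRegion (L : ℝ) : Set (EuclideanSpace ℝ (Fin 2)) :=
  {ξ | 0 < ξ 0 ∧ 0 < ξ 1 ∧ (L ≤ ξ 0 ∨ L ≤ ξ 1)}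

/-- The coefficients `c_{mn}^γ`, for `(m, n) = (1, 0), (0, 1), (1, 1)`, on the element `I_{00}`:
`2, 2, 0` if `γ = 2`, and `1, 1, 1` if `γ < 2`. -/
def originCoeff (γ : ℝ) (m n : ℕ) : ℝ :=
  if γ = 2 then (if m + n = 1 then 2 else 0) else 1

/-- The weighted trapezoidal approximation of `∫_{I_{ij}} ψ_γ(x, ξ) ω_γ(ξ) dξ`. The element at the
origin does not use the vertex `ξ_{00} = 0`: there the limit of `ψ_γ` at the origin is replaced by
`ψ_γ(x, ξ_{10}) + ψ_γ(x, ξ_{01}) - ψ_γ(x, ξ_{11})` if `γ = 2`, and by `0` if `γ < 2`. -/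
def elementQuad (γ α h : ℝ) (u : EuclideanSpace ℝ (Fin 2) → ℝ)
    (x : EuclideanSpace ℝ (Fin 2)) (i j : ℕ) : ℝ :=
  (1 / 4 : ℝ) *
    (if i = 0 ∧ j = 0 then
      originCoeff γ 1 0 * centralQuot γ u x (gridPoint h 1 0) +
        originCoeff γ 0 1 * centralQuot γ u x (gridPoint h 0 1) +
        originCoeff γ 1 1 * centralQuot γ u x (gridPoint h 1 1)
    else
      ∑ m ∈ Finset.range 2, ∑ n ∈ Finset.range 2,
        centralQuot γ u x (gridPoint h (i + m) (j + n))) *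
    ∫ ξ in gridElement h i j, quadWeight γ α ξ

/-- The finite difference approximation `(-Δ)^{α/2}_{h,γ} u(x)`, `h = L / N`: the weighted
trapezoidal rule on the `N²` elements of `(0, L)²`, and on the far region the exact value
`-4 u(x) ∫_{D₂} |ξ|^{-(2+α)} dξ`. -/
def fracLaplacianFD (γ α L : ℝ) (N : ℕ) (u : EuclideanSpace ℝ (Fin 2) → ℝ)
    (x : EuclideanSpace ℝ (Fin 2)) : ℝ :=
  -fracConst 2 α *
    (∑ i ∈ Finset.range N, ∑ j ∈ Finset.range N, elementQuad γ α (L / N) u x i j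
      - 4 * u x * ∫ ξ in farRegion L, ‖ξ‖ ^ (-(2 + α)))

end

/-! Averaging the hypersingular integral over the four sign changes of ξ turns it into an absolutely
convergent integral over the first quadrant, with integrand ψ_2(x, ξ)|ξ|^{-α}. On the far region all
four shifted points leave Ω, so the scheme is exact there. The whole error is that of the weighted
trapezoidal rule on the square (0, L)² (`fracLaplacian_sub_fracLaplacianFD`).

Split the four-point difference into its Hessian part and a remainder R. The Hessian part divided by
|ξ|² is homogeneous of degree 0 and singular at the origin; estimated cell by cell it would only
give order h^{2-α}. But the sign changes remove the mixed term, and adding the value at the point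
with swapped coordinates leaves the constant 2Δu(x) (`hessianPart_add_swap`). The rule is exact for
constants, and grid, weight and vertex average are invariant under the swap, so the errors on I_{ij}
and I_{ji} cancel (`sum_cellError_eq_zero`).

For R, the second derivative is a sum of symmetric second differences of D²u, hence O(|ξ|^{α+ε})
(`IsHolderClass.exists_hessianSymmDiff_le`). On a cell at distance about M from the origin, R/|ξ|²
then has first and symmetric second differences controlled by M^{α+ε-1} and M^{α+ε-2}. The
trapezoidal error, weight included, is therefore at most a multiple of h² times the integral of
|ξ|^{ε-2} over the cell (`abs_cellError_remainder_le`, `abs_cellError_remainder_origin_le`). Since ε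
> 0, this density is integrable on the square, and summation gives O(h²), uniformly in x. -/

open MeasureTheory Filter Topology Set

noncomputable section

/-! ### Symmetric second differences and the Hölder hypothesis -/

section SymmetricRemainder

variable {E : Type*} [NormedAddCommGroup E] [NormedSpace ℝ E]

/-- The second order remainder of the symmetric second difference of `u` at `x`. -/
def symmRemainder (u : E → ℝ) (x η : E) : ℝ :=
  u (x + η) + u (x - η) - 2 * u x - fderiv ℝ (fderiv ℝ u) x η η

/-- The derivative of `symmRemainder u x`. -/
def symmRemainderDeriv (u : E → ℝ) (x η : E) : E →L[ℝ] ℝ :=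
  fderiv ℝ u (x + η) - fderiv ℝ u (x - η) - (2 : ℝ) • fderiv ℝ (fderiv ℝ u) x η

/-- The symmetric second difference of the second derivative of `u`. -/
def hessianSymmDiff (u : E → ℝ) (x η : E) : E →L[ℝ] E →L[ℝ] ℝ :=
  fderiv ℝ (fderiv ℝ u) (x + η) + fderiv ℝ (fderiv ℝ u) (x - η) -
    (2 : ℝ) • fderiv ℝ (fderiv ℝ u) x

theorem hasFDerivAt_translate {F : Type*} [NormedAddCommGroup F] [NormedSpace ℝ F]
    {f : E → F} (hf : Differentiable ℝ f) (x η : E) :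
    HasFDerivAt (fun η => f (x + η)) (fderiv ℝ f (x + η)) η := by
  have h := (hf (x + η)).hasFDerivAt.comp η ((hasFDerivAt_id η).const_add x)
  exact h

theorem hasFDerivAt_reflect {F : Type*} [NormedAddCommGroup F] [NormedSpace ℝ F]
    {f : E → F} (hf : Differentiable ℝ f) (x η : E) :
    HasFDerivAt (fun η => f (x - η)) (-fderiv ℝ f (x - η)) η := by
  have h := (hf (x - η)).hasFDerivAt.comp η ((hasFDerivAt_id η).const_sub x)
  refine h.congr_fderiv ?_
  ext v
  simp

theorem hasFDerivAt_symmRemainder {u : E → ℝ} (hu : ContDiff ℝ 2 u) (x η : E) :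
    HasFDerivAt (symmRemainder u x) (symmRemainderDeriv u x η) η := by
  have hd : Differentiable ℝ u := hu.differentiable (by norm_num)
  have hB := ((fderiv ℝ (fderiv ℝ u) x).hasFDerivAt (x := η)).clm_apply (hasFDerivAt_id η)
  have h := (((hasFDerivAt_translate hd x η).add
    (hasFDerivAt_reflect hd x η)).sub_const (2 * u x)).sub hB
  refine HasFDerivAt.congr_fderiv h ?_
  ext v
  -- Differentiating the quadratic term gives B v η + B η v; symmetry of the Hessian merges these
  -- into 2 B η v.
  have hs : fderiv ℝ (fderiv ℝ u) x v η = fderiv ℝ (fderiv ℝ u) x η v :=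
    (hu.contDiffAt.isSymmSndFDerivAt (by simp)) v η
  simp [symmRemainderDeriv, hs]
  ring

theorem hasFDerivAt_symmRemainderDeriv {u : E → ℝ} (hu : ContDiff ℝ 2 u) (x η : E) :
    HasFDerivAt (symmRemainderDeriv u x) (hessianSymmDiff u x η) η := by
  have hd : Differentiable ℝ (fderiv ℝ u) :=
    (hu.fderiv_right (m := 1) (by norm_num)).differentiable (by norm_num)
  have h := ((hasFDerivAt_translate hd x η).sub
    (hasFDerivAt_reflect hd x η)).sub
      (((fderiv ℝ (fderiv ℝ u) x).hasFDerivAt (x := η)).const_smul (2 : ℝ))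
  refine HasFDerivAt.congr_fderiv h ?_
  simp [hessianSymmDiff]

/-- Bounds on the ball of radius `ρ` for a function that vanishes to second order at the origin
and whose second derivative is at most `κ`. -/
theorem second_order_bounds {S : E → ℝ} {S' : E → E →L[ℝ] ℝ} {S'' : E → E →L[ℝ] E →L[ℝ] ℝ}
    (hS : ∀ η, HasFDerivAt S (S' η) η) (hS' : ∀ η, HasFDerivAt S' (S'' η) η)
    (h0 : S 0 = 0) (h0' : S' 0 = 0) {ρ κ : ℝ} (hκ : 0 ≤ κ)
    (hb : ∀ η, ‖η‖ ≤ ρ → ‖S'' η‖ ≤ κ) :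
    (∀ η, ‖η‖ ≤ ρ → |S η| ≤ κ * ρ ^ 2) ∧
    (∀ a b, ‖a‖ ≤ ρ → ‖b‖ ≤ ρ → |S a - S b| ≤ κ * ρ * ‖a - b‖) ∧
    ∀ c t, ‖c + t‖ ≤ ρ → ‖c - t‖ ≤ ρ → |S (c + t) + S (c - t) - 2 * S c| ≤ 2 * κ * ‖t‖ ^ 2 := by
  have hcv : Convex ℝ (Metric.closedBall (0 : E) ρ) := convex_closedBall 0 ρ
  have hmem : ∀ η : E, η ∈ Metric.closedBall (0 : E) ρ ↔ ‖η‖ ≤ ρ := fun η => by simp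
  have d1 : ∀ a b, ‖a‖ ≤ ρ → ‖b‖ ≤ ρ → ‖S' a - S' b‖ ≤ κ * ‖a - b‖ := fun a b ha hb' =>
    hcv.norm_image_sub_le_of_norm_hasFDerivWithin_le
      (fun η _ => (hS' η).hasFDerivWithinAt) (fun η hη => hb η ((hmem η).1 hη))
      ((hmem b).2 hb') ((hmem a).2 ha)
  have d2 : ∀ η, ‖η‖ ≤ ρ → ‖S' η‖ ≤ κ * ρ := fun η hη => by
    have := d1 η 0 hη (by simpa using (norm_nonneg η).trans hη)
    rw [h0', sub_zero, sub_zero] at this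
    exact this.trans (by gcongr)
  have d3 : ∀ a b, ‖a‖ ≤ ρ → ‖b‖ ≤ ρ → |S a - S b| ≤ κ * ρ * ‖a - b‖ := fun a b ha hb' =>
    hcv.norm_image_sub_le_of_norm_hasFDerivWithin_le
      (fun η _ => (hS η).hasFDerivWithinAt) (fun η hη => d2 η ((hmem η).1 hη))
      ((hmem b).2 hb') ((hmem a).2 ha)
  refine ⟨fun η hη => ?_, d3, fun c t h1 h2 => ?_⟩
  · have hρ : 0 ≤ ρ := (norm_nonneg η).trans hη
    have := d3 η 0 hη (by simpa using hρ)
    rw [h0, sub_zero, sub_zero] at this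
    calc |S η| ≤ κ * ρ * ‖η‖ := this
      _ ≤ κ * ρ * ρ := by gcongr
      _ = _ := by ring
  · have hseg : ∀ s ∈ Icc (0 : ℝ) 1, ‖c + s • t‖ ≤ ρ ∧ ‖c - s • t‖ ≤ ρ := by
      intro s hs
      have key : ∀ r ∈ Icc (-1 : ℝ) 1, ‖c + r • t‖ ≤ ρ := by
        intro r hr
        have : c + r • t = ((1 + r) / 2) • (c + t) + ((1 - r) / 2) • (c - t) := by
          module
        rw [this, ← hmem]
        exact hcv ((hmem _).2 h1) ((hmem _).2 h2) (by linarith [hr.1]) (by linarith [hr.2])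
          (by ring)
      refine ⟨key s ⟨by linarith [hs.1], hs.2⟩, ?_⟩
      simpa [sub_eq_add_neg] using key (-s) ⟨by linarith [hs.2], by linarith [hs.1]⟩
    have hder : ∀ s : ℝ, HasDerivAt (fun s : ℝ => S (c + s • t) + S (c - s • t))
        ((S' (c + s • t) - S' (c - s • t)) t) s := by
      intro s
      have e1 : HasDerivAt (fun s : ℝ => c + s • t) t s := by
        simpa using ((hasDerivAt_id s).smul_const t).const_add c
      have e2 : HasDerivAt (fun s : ℝ => c - s • t) (-t) s := by
        simpa using ((hasDerivAt_id s).smul_const t).const_sub c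
      have := ((hS (c + s • t)).comp_hasDerivAt s e1).add ((hS (c - s • t)).comp_hasDerivAt s e2)
      refine this.congr_deriv ?_
      rw [map_neg, ← sub_eq_add_neg]
      rfl
    have := (convex_Icc (0 : ℝ) 1).norm_image_sub_le_of_norm_hasDerivWithin_le
      (C := 2 * κ * ‖t‖ ^ 2) (fun s _ => (hder s).hasDerivWithinAt)
      (fun s hs => by
        have h3 := d1 _ _ (hseg s hs).1 (hseg s hs).2
        have h4 : c + s • t - (c - s • t) = (2 * s) • t := by module
        rw [h4, norm_smul, Real.norm_of_nonneg (by linarith [hs.1])] at h3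
        calc ‖(S' (c + s • t) - S' (c - s • t)) t‖
            ≤ ‖S' (c + s • t) - S' (c - s • t)‖ * ‖t‖ := ContinuousLinearMap.le_opNorm _ _
          _ ≤ (κ * (2 * s * ‖t‖)) * ‖t‖ := by gcongr
          _ ≤ (κ * (2 * 1 * ‖t‖)) * ‖t‖ := by gcongr; exact hs.2
          _ = _ := by ring)
      (left_mem_Icc.2 zero_le_one) (right_mem_Icc.2 zero_le_one)
    simp only [one_smul, zero_smul, add_zero, sub_zero, norm_one, mul_one] at this
    rw [Real.norm_eq_abs] at this
    convert this using 2
    ring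

/-- Links the two forms of the second derivative: the Hölder hypothesis speaks of `iteratedFDeriv`,
the Taylor remainder of nested `fderiv`. -/
theorem norm_bilin_le_of_multilin {A : ContinuousMultilinearMap ℝ (fun _ : Fin 2 => E) ℝ}
    {B : E →L[ℝ] E →L[ℝ] ℝ} (h : ∀ v w, B v w = A ![v, w]) : ‖B‖ ≤ ‖A‖ := by
  refine B.opNorm_le_bound₂ (norm_nonneg A) fun v w => ?_
  rw [h v w]
  simpa [Fin.prod_univ_two, mul_assoc] using A.le_opNorm ![v, w]

theorem hessianSymmDiff_norm_le {u : E → ℝ} (x η : E) :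
    ‖hessianSymmDiff u x η‖ ≤ ‖iteratedFDeriv ℝ 2 u (x + η) + iteratedFDeriv ℝ 2 u (x - η) -
      (2 : ℝ) • iteratedFDeriv ℝ 2 u x‖ := by
  refine norm_bilin_le_of_multilin fun v w => ?_
  simp [hessianSymmDiff, iteratedFDeriv_two_apply]

theorem norm_symm_diff_le_of_holder {E F : Type*} [NormedAddCommGroup E] [NormedAddCommGroup F] [NormedSpace ℝ F]
    {f : E → F} {K β : ℝ} (h : ∀ x y, ‖f x - f y‖ ≤ K * ‖x - y‖ ^ β) (x η : E) :
    ‖f (x + η) + f (x - η) - (2 : ℝ) • f x‖ ≤ 2 * K * ‖η‖ ^ β := by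
  have h1 := h (x + η) x
  have h2 := h (x - η) x
  rw [add_sub_cancel_left] at h1
  rw [sub_sub_cancel_left, norm_neg] at h2
  have : f (x + η) + f (x - η) - (2 : ℝ) • f x = (f (x + η) - f x) + (f (x - η) - f x) := by
    module
  rw [this]
  linarith [norm_add_le (f (x + η) - f x) (f (x - η) - f x)]

/-- Mean value inequality for t ↦ f(x + t) + f(x - t): its derivative f'(x + t) - f'(x - t) compares
points at distance 2|t|, so one more derivative gains one more power of |η|. -/
theorem norm_symm_diff_le_of_fderiv_holder {F : Type*} [NormedAddCommGroup F] [NormedSpace ℝ F]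
    {f : E → F} (hf : Differentiable ℝ f) {K s : ℝ} (hK : 0 ≤ K) (hs : 0 ≤ s)
    (h : ∀ x y, ‖fderiv ℝ f x - fderiv ℝ f y‖ ≤ K * ‖x - y‖ ^ s) (x η : E) :
    ‖f (x + η) + f (x - η) - (2 : ℝ) • f x‖ ≤ K * 2 ^ s * ‖η‖ ^ (1 + s) := by
  rcases eq_or_ne η 0 with rfl | hη
  · have : f (x + 0) + f (x - 0) - (2 : ℝ) • f x = 0 := by rw [add_zero, sub_zero]; module
    rw [this, norm_zero]; positivity
  have hη' : 0 < ‖η‖ := norm_pos_iff.2 hη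
  have hder : ∀ t, HasFDerivAt (fun t => f (x + t) + f (x - t))
      (fderiv ℝ f (x + t) - fderiv ℝ f (x - t)) t := fun t =>
    ((hasFDerivAt_translate hf x t).add (hasFDerivAt_reflect hf x t)).congr_fderiv
      (sub_eq_add_neg _ _).symm
  have := (convex_closedBall (0 : E) ‖η‖).norm_image_sub_le_of_norm_hasFDerivWithin_le
    (C := K * (2 * ‖η‖) ^ s) (fun t _ => (hder t).hasFDerivWithinAt)
    (fun t ht => by
      refine (h _ _).trans ?_
      have h4 : x + t - (x - t) = (2 : ℝ) • t := by module
      rw [h4, norm_smul, Real.norm_of_nonneg zero_le_two]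
      have : ‖t‖ ≤ ‖η‖ := by simpa using ht
      gcongr)
    (x := 0) (y := η) (by simp) (by simp)
  simp only [add_zero, sub_zero] at this
  have e : f (x + η) + f (x - η) - (2 : ℝ) • f x = f (x + η) + f (x - η) - (f x + f x) := by module
  rw [e]
  refine this.trans (le_of_eq ?_)
  rw [Real.mul_rpow zero_le_two hη'.le, Real.rpow_add hη', Real.rpow_one]
  ring

/-- Currying is a linear isometry, so a Hölder bound on the derivative of order n + 1 is one on the
Fréchet derivative of the derivative of order n. -/
theorem norm_iteratedFDeriv_succ_sub {F : Type*} [NormedAddCommGroup F] [NormedSpace ℝ F]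
    (f : E → F) (n : ℕ) (x y : E) :
    ‖fderiv ℝ (iteratedFDeriv ℝ n f) x - fderiv ℝ (iteratedFDeriv ℝ n f) y‖ =
      ‖iteratedFDeriv ℝ (n + 1) f x - iteratedFDeriv ℝ (n + 1) f y‖ := by
  rw [iteratedFDeriv_succ_eq_comp_left]
  have h := (continuousMultilinearCurryLeftEquiv ℝ (fun _ : Fin (n + 1) => E) F).symm.dist_map
    (fderiv ℝ (iteratedFDeriv ℝ n f) x) (fderiv ℝ (iteratedFDeriv ℝ n f) y)
  rw [dist_eq_norm, dist_eq_norm] at h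
  exact h.symm

theorem symmRemainder_bounds {u : E → ℝ} (hu : ContDiff ℝ 2 u) {x : E} {K β : ℝ} (hK : 0 ≤ K)
    (hβ : 0 ≤ β) (h : ∀ η, ‖hessianSymmDiff u x η‖ ≤ K * ‖η‖ ^ β) {ρ : ℝ} (hρ : 0 ≤ ρ) :
    (∀ η, ‖η‖ ≤ ρ → |symmRemainder u x η| ≤ K * ρ ^ β * ρ ^ 2) ∧
    (∀ a b, ‖a‖ ≤ ρ → ‖b‖ ≤ ρ →
      |symmRemainder u x a - symmRemainder u x b| ≤ K * ρ ^ β * ρ * ‖a - b‖) ∧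
    ∀ c t, ‖c + t‖ ≤ ρ → ‖c - t‖ ≤ ρ →
      |symmRemainder u x (c + t) + symmRemainder u x (c - t) - 2 * symmRemainder u x c|
        ≤ 2 * (K * ρ ^ β) * ‖t‖ ^ 2 := by
  refine second_order_bounds (hasFDerivAt_symmRemainder hu x) (hasFDerivAt_symmRemainderDeriv hu x)
    ?_ ?_ (by positivity) fun η hη => (h η).trans (by gcongr)
  · simp [symmRemainder]; ring
  · simp [symmRemainderDeriv]

end SymmetricRemainder

/-- For α < 1 the Hessian itself is Hölder with exponent α + ε. For 1 ≤ α < 2 the third derivative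
is Hölder with exponent α - 1 + ε, and the symmetric difference of the Hessian recovers the missing
power. The constant does not depend on the base point. -/
theorem IsHolderClass.exists_hessianSymmDiff_le {d : ℕ} {α ε : ℝ} (hα0 : 0 < α) (hα2 : α < 2)
    (hε0 : 0 < ε) {u : EuclideanSpace ℝ (Fin d) → ℝ}
    (hu : IsHolderClass (2 + ⌊α⌋₊) (α - (⌊α⌋₊ : ℝ) + ε) u) :
    ContDiff ℝ 2 u ∧ ∃ K : ℝ, 0 ≤ K ∧ ∀ x η, ‖hessianSymmDiff u x η‖ ≤ K * ‖η‖ ^ (α + ε) := by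
  obtain ⟨hc, K, hK⟩ := hu
  have hK' : ∀ x y, ‖iteratedFDeriv ℝ (2 + ⌊α⌋₊) u x - iteratedFDeriv ℝ (2 + ⌊α⌋₊) u y‖ ≤
      |K| * ‖x - y‖ ^ (α - (⌊α⌋₊ : ℝ) + ε) := fun x y =>
    (hK x y).trans (by gcongr; exact le_abs_self K)
  have hc2 : ContDiff ℝ 2 u := hc.of_le (by exact_mod_cast Nat.le_add_right 2 _)
  refine ⟨hc2, ?_⟩
  have hfl : ⌊α⌋₊ < 2 := (Nat.floor_lt hα0.le).2 (by exact_mod_cast hα2)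
  have hle : (⌊α⌋₊ : ℝ) ≤ α := Nat.floor_le hα0.le
  generalize ⌊α⌋₊ = k at *
  interval_cases k
  · simp only [Nat.cast_zero, sub_zero] at hK'
    exact ⟨2 * |K|, by positivity, fun x η => (hessianSymmDiff_norm_le x η).trans
      (norm_symm_diff_le_of_holder hK' x η)⟩
  · simp only [Nat.cast_one] at hK' hle
    refine ⟨|K| * 2 ^ (α - 1 + ε), by positivity, fun x η =>
      (hessianSymmDiff_norm_le x η).trans ?_⟩
    have hd : Differentiable ℝ (iteratedFDeriv ℝ 2 u) :=
      hc.differentiable_iteratedFDeriv (by norm_num)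
    have := norm_symm_diff_le_of_fderiv_holder hd (abs_nonneg K)
      (by linarith : 0 ≤ α - 1 + ε)
      (fun x y => (norm_iteratedFDeriv_succ_sub u 2 x y).trans_le (hK' x y)) x η
    rwa [show 1 + (α - 1 + ε) = α + ε by ring] at this

/-! ### Coordinate symmetries of the plane and integrals over a quadrant -/

/-- The Euclidean plane. -/
abbrev Plane : Type := EuclideanSpace ℝ (Fin 2)

theorem Plane.norm_sq (ξ : Plane) : ‖ξ‖ ^ 2 = ξ 0 ^ 2 + ξ 1 ^ 2 := by
  rw [EuclideanSpace.norm_sq_eq, Fin.sum_univ_two]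
  simp

theorem Plane.norm_le (ξ : Plane) : ‖ξ‖ ≤ |ξ 0| + |ξ 1| := by
  refine abs_le_of_sq_le_sq' ?_ (by positivity) |>.2
  rw [Plane.norm_sq, add_sq, sq_abs, sq_abs]
  nlinarith [mul_nonneg (abs_nonneg (ξ 0)) (abs_nonneg (ξ 1))]

theorem Plane.abs_coord_le (ξ : Plane) (i : Fin 2) : |ξ i| ≤ ‖ξ‖ := by
  simpa using PiLp.norm_apply_le ξ i

/-- The reflection that changes the sign of the coordinate `i`. -/
def reflectCoord (i : Fin 2) : Plane ≃ₗᵢ[ℝ] Plane :=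
  LinearIsometryEquiv.piLpCongrRight 2
    fun j => if j = i then LinearIsometryEquiv.neg ℝ else LinearIsometryEquiv.refl ℝ ℝ

theorem reflectCoord_apply (i j : Fin 2) (ξ : Plane) :
    reflectCoord i ξ j = if j = i then -ξ j else ξ j := by
  rw [reflectCoord, LinearIsometryEquiv.piLpCongrRight_apply]
  simp only
  split_ifs <;> simp

/-- The exchange of the two coordinates. -/
def swapCoord : Plane ≃ₗᵢ[ℝ] Plane :=
  LinearIsometryEquiv.piLpCongrLeft 2 ℝ ℝ (Equiv.swap 0 1)

theorem swapCoord_apply_zero (ξ : Plane) : swapCoord ξ 0 = ξ 1 := by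
  simp [swapCoord, LinearIsometryEquiv.piLpCongrLeft_apply, Equiv.piCongrLeft']

theorem swapCoord_apply_one (ξ : Plane) : swapCoord ξ 1 = ξ 0 := by
  simp [swapCoord, LinearIsometryEquiv.piLpCongrLeft_apply, Equiv.piCongrLeft']

theorem setIntegral_comp_isometry (e : Plane ≃ₗᵢ[ℝ] Plane) (f : Plane → ℝ) (s : Set Plane) :
    ∫ ξ in e ⁻¹' s, f (e ξ) = ∫ ξ in s, f ξ :=
  e.measurePreserving.setIntegral_preimage_emb e.toHomeomorph.measurableEmbedding f s

theorem integrableOn_comp_isometry (e : Plane ≃ₗᵢ[ℝ] Plane) {f : Plane → ℝ} {s : Set Plane} :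
    IntegrableOn (fun ξ => f (e ξ)) (e ⁻¹' s) ↔ IntegrableOn f s :=
  e.measurePreserving.integrableOn_comp_preimage e.toHomeomorph.measurableEmbedding

theorem volume_coord_eq (i : Fin 2) (a : ℝ) : volume {ξ : Plane | ξ i = a} = 0 := by
  have h : MeasurableSet {f : Fin 2 → ℝ | f i = a} :=
    measurableSet_eq_fun (measurable_pi_apply i) measurable_const
  have := (PiLp.volume_preserving_ofLp (Fin 2)).measure_preimage h.nullMeasurableSet
  exact this.trans (Measure.pi_hyperplane (μ := fun _ : Fin 2 => (volume : Measure ℝ)) i a)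

theorem measurable_coord (i : Fin 2) : Measurable fun ξ : Plane => ξ i := by fun_prop

theorem integral_eq_two_mul_half {F : Plane → ℝ} (i : Fin 2) (hF : Integrable F)
    (hsymm : ∀ ξ, F (reflectCoord i ξ) = F ξ) : ∫ ξ, F ξ = 2 * ∫ ξ in {ξ | 0 < ξ i}, F ξ := by
  have hm : MeasurableSet {ξ : Plane | 0 < ξ i} :=
    measurableSet_lt measurable_const (measurable_coord i)
  rw [← integral_add_compl hm hF, two_mul]
  congr 1
  have hae : ({ξ : Plane | 0 < ξ i}ᶜ : Set Plane) =ᵐ[volume]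
      (reflectCoord i ⁻¹' {ξ | 0 < ξ i} : Set Plane) := by
    have h0 : ∀ᵐ ξ : Plane, ξ i ≠ 0 := by
      rw [ae_iff]; simpa using volume_coord_eq i 0
    filter_upwards [h0] with ξ hξ
    apply propext
    change ¬ (0 < ξ i) ↔ 0 < reflectCoord i ξ i
    rw [reflectCoord_apply, if_pos rfl, not_lt, neg_pos]
    exact ⟨fun h => lt_of_le_of_ne h hξ, le_of_lt⟩
  rw [setIntegral_congr_set hae]
  simpa only [hsymm] using setIntegral_comp_isometry (reflectCoord i) F {ξ | 0 < ξ i}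

/-- The open first quadrant. -/
def firstQuadrant : Set Plane := {ξ | 0 < ξ 0 ∧ 0 < ξ 1}

theorem integral_eq_four_mul_quadrant {F : Plane → ℝ} (hF : Integrable F)
    (hsymm : ∀ i ξ, F (reflectCoord i ξ) = F ξ) :
    ∫ ξ, F ξ = 4 * ∫ ξ in firstQuadrant, F ξ := by
  have hm0 : MeasurableSet {ξ : Plane | 0 < ξ 0} :=
    measurableSet_lt measurable_const (measurable_coord 0)
  have hm1 : MeasurableSet {ξ : Plane | 0 < ξ 1} :=
    measurableSet_lt measurable_const (measurable_coord 1)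
  -- Writing the half-plane integral with an indicator gives a function on the whole plane, still
  -- even in the second coordinate, to be halved again.
  rw [integral_eq_two_mul_half 0 hF (hsymm 0), ← integral_indicator hm0,
    integral_eq_two_mul_half 1 (hF.indicator hm0), setIntegral_indicator hm0, inter_comm,
    ← mul_assoc]
  · norm_num
    rfl
  · intro ξ
    simp only [indicator, mem_ofPred_eq, hsymm, reflectCoord_apply]
    simp

/-! ### Integrability of powers of the norm -/

theorem integrableOn_norm_rpow_of_isBounded {a : ℝ} (ha : -2 < a) {s : Set Plane}
    (hs : Bornology.IsBounded s) : IntegrableOn (fun ξ : Plane => ‖ξ‖ ^ a) s := by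
  obtain ⟨R, -, hR⟩ := hs.exists_pos_norm_lt
  refine IntegrableOn.mono_set (t := Metric.ball 0 R) ?_ fun ξ hξ => mem_ball_zero_iff.2 (hR ξ hξ)
  refine integrableOn_ball_of_norm_le_rpow (α := -a) (C := 1) (by simp) (by simpa using by linarith)
    (ae_of_all _ fun ξ => ?_) (measurable_norm.pow_const a).aestronglyMeasurable
  rw [neg_neg, one_mul, Real.norm_of_nonneg (by positivity)]

/-- Outside the ball, 1 + |ξ| ≤ (1 + 1/r)|ξ|, so the integrable function (1 + |ξ|)^{-a} dominates up
to a constant. -/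
theorem integrableOn_norm_rpow_compl_ball {a : ℝ} (ha : 2 < a) {r : ℝ} (hr : 0 < r) :
    IntegrableOn (fun ξ : Plane => ‖ξ‖ ^ (-a)) (Metric.ball 0 r)ᶜ := by
  have h := (integrable_one_add_norm (E := Plane) (μ := volume) (r := a)
    (by simpa using ha)).const_mul ((1 + 1 / r) ^ a)
  refine Integrable.mono' h.integrableOn (measurable_norm.pow_const _).aestronglyMeasurable
    ((ae_restrict_iff' Metric.isOpen_ball.measurableSet.compl).2 (ae_of_all _ fun ξ hξ => ?_))
  have hξ' : r ≤ ‖ξ‖ := by simpa using hξ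
  have hpos : 0 < ‖ξ‖ := hr.trans_le hξ'
  rw [Real.norm_of_nonneg (by positivity), Real.rpow_neg hpos.le, Real.rpow_neg (by positivity),
    ← div_eq_mul_inv, ← one_div, ← Real.div_rpow (by positivity) (by positivity),
    ← Real.one_rpow a, ← Real.div_rpow zero_le_one hpos.le, Real.one_rpow]
  refine Real.rpow_le_rpow (by positivity) ?_ (by linarith)
  rw [div_le_div_iff₀ hpos (by positivity)]
  have : 1 ≤ ‖ξ‖ / r := (one_le_div hr).2 hξ'
  calc 1 * (1 + ‖ξ‖) ≤ ‖ξ‖ / r + ‖ξ‖ := by linarith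
    _ = _ := by ring

theorem tendsto_integral_compl_ball {F : Plane → ℝ} (hF : Integrable F) :
    Tendsto (fun r => ∫ ξ in (Metric.ball (0 : Plane) r)ᶜ, F ξ) (𝓝[>] 0) (𝓝 (∫ ξ, F ξ)) := by
  have hm : ∀ r : ℝ, MeasurableSet (Metric.ball (0 : Plane) r)ᶜ := fun r =>
    Metric.isOpen_ball.measurableSet.compl
  simp_rw [← integral_indicator (hm _)]
  refine tendsto_integral_filter_of_dominated_convergence (fun ξ => ‖F ξ‖)
    (Eventually.of_forall fun r => (hF.indicator (hm r)).aestronglyMeasurable)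
    (Eventually.of_forall fun r => ae_of_all _ fun ξ => norm_indicator_le_norm_self _ _) hF.norm ?_
  have h0 : ∀ᵐ ξ : Plane, ξ ≠ 0 := by simp [ae_iff]
  filter_upwards [h0] with ξ hξ
  refine tendsto_const_nhds.congr' ?_
  have : Iio ‖ξ‖ ∈ 𝓝[>] (0 : ℝ) := mem_nhdsWithin_of_mem_nhds (Iio_mem_nhds (norm_pos_iff.2 hξ))
  filter_upwards [this] with r hr
  rw [indicator_of_mem]
  simpa using le_of_lt hr

/-! ### Symmetrization and existence of the principal value -/

/-- The sum of `u` over the four points `x + (±ξ₀, ±ξ₁)`, minus `4 u(x)`. -/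
def fourPointDiff (u : Plane → ℝ) (x ξ : Plane) : ℝ :=
  (u (x + ξ) + u (x - ξ) - 2 * u x) +
    (u (x + reflectCoord 1 ξ) + u (x - reflectCoord 1 ξ) - 2 * u x)

theorem reflectCoord_one_involutive (ξ : Plane) : reflectCoord 1 (reflectCoord 1 ξ) = ξ := by
  ext j
  simp only [reflectCoord_apply]
  split_ifs <;> simp

theorem reflectCoord_zero_eq (ξ : Plane) : reflectCoord 0 ξ = -reflectCoord 1 ξ := by
  ext j
  fin_cases j <;> simp [reflectCoord_apply]

theorem centralQuot_two_eq (u : Plane → ℝ) (x ξ : Plane) :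
    centralQuot 2 u x ξ = fourPointDiff u x ξ / ‖ξ‖ ^ 2 := by
  have h1 : !₂[x 0 + ξ 0, x 1 + ξ 1] = x + ξ := by ext j; fin_cases j <;> simp
  have h2 : !₂[x 0 + ξ 0, x 1 + -ξ 1] = x + reflectCoord 1 ξ := by
    ext j; fin_cases j <;> simp [reflectCoord_apply]
  have h3 : !₂[x 0 + -ξ 0, x 1 + ξ 1] = x - reflectCoord 1 ξ := by
    ext j; fin_cases j <;> simp [reflectCoord_apply, sub_eq_add_neg]
  have h4 : !₂[x 0 + -ξ 0, x 1 + -ξ 1] = x - ξ := by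
    ext j; fin_cases j <;> simp [sub_eq_add_neg]
  simp only [centralQuot, Finset.sum_range_succ, Finset.sum_range_zero, pow_zero, pow_one, one_mul,
    neg_mul, zero_add, h1, h2, h3, h4, fourPointDiff]
  rw [show ‖ξ‖ ^ (2 : ℝ) = ‖ξ‖ ^ 2 by exact_mod_cast Real.rpow_natCast ‖ξ‖ 2]
  congr 1
  ring

theorem fourPointDiff_zero (u : Plane → ℝ) (x : Plane) : fourPointDiff u x 0 = 0 := by
  simp [fourPointDiff]; ring

theorem fourPointDiff_reflect (u : Plane → ℝ) (x : Plane) (i : Fin 2) (ξ : Plane) :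
    fourPointDiff u x (reflectCoord i ξ) = fourPointDiff u x ξ := by
  have h : fourPointDiff u x (reflectCoord 1 ξ) = fourPointDiff u x ξ := by
    simp only [fourPointDiff, reflectCoord_one_involutive]; ring
  fin_cases i
  · simp only [Fin.zero_eta]
    rw [← h, reflectCoord_zero_eq]
    simp only [fourPointDiff, map_neg, sub_neg_eq_add, ← sub_eq_add_neg]; ring
  · exact h

/-- The integrand of the fractional Laplacian after symmetrization. -/
def symmIntegrand (α : ℝ) (u : Plane → ℝ) (x ξ : Plane) : ℝ :=
  fourPointDiff u x ξ * ‖ξ‖ ^ (-(2 + α))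

theorem centralQuot_mul_quadWeight (α : ℝ) (u : Plane → ℝ) (x ξ : Plane) :
    centralQuot 2 u x ξ * quadWeight 2 α ξ = symmIntegrand α u x ξ := by
  rw [centralQuot_two_eq, quadWeight, symmIntegrand]
  -- At the origin both sides vanish, because the four-point difference does.
  rcases eq_or_ne ξ 0 with rfl | hξ
  · simp [fourPointDiff_zero]
  have hpos : 0 < ‖ξ‖ := norm_pos_iff.2 hξ
  rw [sub_eq_add_neg, Real.rpow_add hpos,
    show ‖ξ‖ ^ (2 : ℝ) = ‖ξ‖ ^ 2 by exact_mod_cast Real.rpow_natCast ‖ξ‖ 2]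
  field_simp

theorem continuous_fourPointDiff {u : Plane → ℝ} (hu : Continuous u) (x : Plane) :
    Continuous (fourPointDiff u x) := by
  have := (reflectCoord 1).continuous
  unfold fourPointDiff
  fun_prop

theorem measurable_symmIntegrand {α : ℝ} {u : Plane → ℝ} (hu : Continuous u) (x : Plane) :
    Measurable (symmIntegrand α u x) :=
  (continuous_fourPointDiff hu x).measurable.mul (measurable_norm.pow_const _)

theorem abs_fourPointDiff_le_of_bound {u : Plane → ℝ} {M : ℝ} (hM : ∀ x, |u x| ≤ M) (x ξ : Plane) :
    |fourPointDiff u x ξ| ≤ 8 * M := by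
  rw [fourPointDiff, abs_le]
  have h := fun y => abs_le.1 (hM y)
  constructor <;> linarith [h x, h (x + ξ), h (x - ξ), h (x + reflectCoord 1 ξ),
    h (x - reflectCoord 1 ξ)]

/-- The quadratic bound leaves |ξ|^{-α} near the origin, integrable because α < 2; boundedness of u
leaves |ξ|^{-(2+α)} at infinity, integrable because α > 0. -/
theorem integrable_symmIntegrand {α : ℝ} (hα0 : 0 < α) (hα2 : α < 2) {u : Plane → ℝ}
    (hu : Continuous u) {M : ℝ} (hM : ∀ x, |u x| ≤ M) {x : Plane} {C : ℝ}
    (hC : ∀ ξ, ‖ξ‖ ≤ 1 → |fourPointDiff u x ξ| ≤ C * ‖ξ‖ ^ 2) :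
    Integrable (symmIntegrand α u x) := by
  rw [← integrableOn_univ, ← union_compl_self (Metric.ball (0 : Plane) 1)]
  have hm := measurable_symmIntegrand (α := α) hu x
  refine IntegrableOn.union ?_ ?_
  · refine Integrable.mono' ((integrableOn_norm_rpow_of_isBounded (a := -α) (by linarith)
      Metric.isBounded_ball).const_mul C) hm.aestronglyMeasurable
      ((ae_restrict_iff' Metric.isOpen_ball.measurableSet).2 (ae_of_all _ fun ξ hξ => ?_))
    rw [symmIntegrand, norm_mul, Real.norm_eq_abs, Real.norm_of_nonneg (by positivity)]
    rcases eq_or_ne ξ 0 with rfl | hne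
    · simp [fourPointDiff_zero, Real.zero_rpow (neg_ne_zero.2 hα0.ne')]
    have hpos : 0 < ‖ξ‖ := norm_pos_iff.2 hne
    calc |fourPointDiff u x ξ| * ‖ξ‖ ^ (-(2 + α))
        ≤ (C * ‖ξ‖ ^ 2) * ‖ξ‖ ^ (-(2 + α)) := by
          gcongr
          exact hC ξ (le_of_lt (by simpa using hξ))
      _ = C * ‖ξ‖ ^ (-α) := by
          rw [mul_assoc, ← Real.rpow_natCast, ← Real.rpow_add hpos]
          congr 2; push_cast; ring
  · refine Integrable.mono' ((integrableOn_norm_rpow_compl_ball (a := 2 + α) (by linarith)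
      one_pos).const_mul (8 * M)) hm.aestronglyMeasurable (ae_of_all _ fun ξ => ?_)
    rw [symmIntegrand, norm_mul, Real.norm_eq_abs, Real.norm_of_nonneg (by positivity)]
    gcongr
    exact abs_fourPointDiff_le_of_bound hM x ξ

theorem preimage_compl_ball (x : Plane) (r : ℝ) :
    (fun ξ => x + ξ) ⁻¹' (Metric.ball x r)ᶜ = (Metric.ball (0 : Plane) r)ᶜ := by
  ext ξ; simp

theorem fracIntegrand_add (α : ℝ) (u : Plane → ℝ) (x ξ : Plane) :
    fracIntegrand α u x (x + ξ) = (u x - u (x + ξ)) * ‖ξ‖ ^ (-(2 + α)) := by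
  rw [fracIntegrand, sub_add_cancel_left, norm_neg, Real.rpow_neg (norm_nonneg _), div_eq_mul_inv]
  norm_num

theorem integrableOn_shifted {α : ℝ} (hα0 : 0 < α) {u : Plane → ℝ} (hu : Continuous u) {M : ℝ}
    (hM : ∀ x, |u x| ≤ M) (x : Plane) {r : ℝ} (hr : 0 < r) :
    IntegrableOn (fun ξ => (u x - u (x + ξ)) * ‖ξ‖ ^ (-(2 + α))) (Metric.ball (0 : Plane) r)ᶜ := by
  refine Integrable.mono' ((integrableOn_norm_rpow_compl_ball (a := 2 + α) (by linarith)
      hr).const_mul (2 * M)) ?_ (ae_of_all _ fun ξ => ?_)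
  · have : Measurable fun ξ => u x - u (x + ξ) := by
      apply Continuous.measurable; fun_prop
    exact (this.mul (measurable_norm.pow_const _)).aestronglyMeasurable
  · rw [norm_mul, Real.norm_eq_abs, Real.norm_of_nonneg (r := ‖ξ‖ ^ _) (by positivity)]
    gcongr
    have h := fun y => abs_le.1 (hM y)
    rw [abs_le]
    constructor <;> linarith [h x, h (x + ξ)]

theorem integrableOn_fracIntegrand {α : ℝ} (hα0 : 0 < α) {u : Plane → ℝ} (hu : Continuous u)
    {M : ℝ} (hM : ∀ x, |u x| ≤ M) (x : Plane) {r : ℝ} (hr : 0 < r) :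
    IntegrableOn (fracIntegrand α u x) (Metric.ball x r)ᶜ := by
  rw [← (measurePreserving_add_left volume x).integrableOn_comp_preimage
    (measurableEmbedding_addLeft x), preimage_compl_ball]
  simpa only [Function.comp_def, fracIntegrand_add] using integrableOn_shifted hα0 hu hM x hr

/-- After translation the punctured domain is invariant under ±1 and ± the reflection. The four
transformed copies of the integrand have equal integrals, and their sum is minus the symmetrized
integrand. -/
theorem setIntegral_fracIntegrand {α : ℝ} (hα0 : 0 < α) {u : Plane → ℝ} (hu : Continuous u)
    {M : ℝ} (hM : ∀ x, |u x| ≤ M) (x : Plane) {r : ℝ} (hr : 0 < r) :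
    ∫ x' in (Metric.ball x r)ᶜ, fracIntegrand α u x x' =
      -(1 / 4) * ∫ ξ in (Metric.ball (0 : Plane) r)ᶜ, symmIntegrand α u x ξ := by
  have hg := integrableOn_shifted hα0 hu hM x hr
  rw [← (measurePreserving_add_left volume x).setIntegral_preimage_emb
    (measurableEmbedding_addLeft x), preimage_compl_ball]
  simp only [fracIntegrand_add]
  set g : Plane → ℝ := fun ξ => (u x - u (x + ξ)) * ‖ξ‖ ^ (-(2 + α)) with hgdef
  set B : Set Plane := (Metric.ball (0 : Plane) r)ᶜ with hB
  have hpre : ∀ e : Plane ≃ₗᵢ[ℝ] Plane, e ⁻¹' B = B := fun e => by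
    ext ξ; simp [hB]
  have hI : ∀ e : Plane ≃ₗᵢ[ℝ] Plane, ∫ ξ in B, g (e ξ) = ∫ ξ in B, g ξ := fun e => by
    simpa only [hpre] using setIntegral_comp_isometry e g B
  have hi : ∀ e : Plane ≃ₗᵢ[ℝ] Plane, IntegrableOn (fun ξ => g (e ξ)) B := fun e => by
    have := (integrableOn_comp_isometry e (f := g) (s := B)).2 hg
    rwa [hpre] at this
  let n : Plane ≃ₗᵢ[ℝ] Plane := LinearIsometryEquiv.neg ℝ
  let ρ := reflectCoord 1
  let σ := ρ.trans n
  have hsum : ∀ ξ, symmIntegrand α u x ξ = -(g ξ + g (n ξ) + g (ρ ξ) + g (σ ξ)) := by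
    intro ξ
    have e1 : n ξ = -ξ := rfl
    have e2 : σ ξ = -ρ ξ := rfl
    have e3 : ‖ρ ξ‖ = ‖ξ‖ := ρ.norm_map ξ
    simp only [hgdef, symmIntegrand, fourPointDiff, e1, e2, norm_neg, e3, ← sub_eq_add_neg]
    ring
  have hnρ : IntegrableOn (fun ξ => g ξ + g (n ξ)) B := hg.add (hi n)
  have hnρ' : IntegrableOn (fun ξ => g ξ + g (n ξ) + g (ρ ξ)) B := hnρ.add (hi ρ)
  simp only [hsum]
  rw [integral_neg, integral_add hnρ' (hi σ), integral_add hnρ (hi ρ), integral_add hg (hi n),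
    hI n, hI ρ, hI σ]
  ring

theorem tendsto_fracLaplacianTrunc {α : ℝ} (hα0 : 0 < α) {u : Plane → ℝ} (hu : Continuous u)
    {M : ℝ} (hM : ∀ x, |u x| ≤ M) {x : Plane} (hint : Integrable (symmIntegrand α u x)) :
    Tendsto (fracLaplacianTrunc α u x) (𝓝[>] 0)
      (𝓝 (-fracConst 2 α * ∫ ξ in firstQuadrant, symmIntegrand α u x ξ)) := by
  have hlim : -fracConst 2 α * ∫ ξ in firstQuadrant, symmIntegrand α u x ξ =
      fracConst 2 α * (-(1 / 4) * ∫ ξ, symmIntegrand α u x ξ) := by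
    rw [integral_eq_four_mul_quadrant hint fun i ξ => by
      rw [symmIntegrand, symmIntegrand, fourPointDiff_reflect, LinearIsometryEquiv.norm_map]]
    ring
  rw [hlim]
  refine (((tendsto_integral_compl_ball hint).const_mul (-(1 / 4))).const_mul _).congr' ?_
  filter_upwards [self_mem_nhdsWithin] with r hr
  rw [fracLaplacianTrunc, setIntegral_fracIntegrand hα0 hu hM x hr]

theorem fracLaplacian_eq {α : ℝ} (hα0 : 0 < α) {u : Plane → ℝ} (hu : Continuous u)
    {M : ℝ} (hM : ∀ x, |u x| ≤ M) {x : Plane} (hint : Integrable (symmIntegrand α u x)) :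
    fracLaplacian α u x = -fracConst 2 α * ∫ ξ in firstQuadrant, symmIntegrand α u x ξ :=
  (tendsto_fracLaplacianTrunc hα0 hu hM hint).limUnder_eq

theorem fracLaplacianExists_of_integrable {α : ℝ} (hα0 : 0 < α) {u : Plane → ℝ}
    (hu : Continuous u) {M : ℝ} (hM : ∀ x, |u x| ≤ M) {x : Plane}
    (hint : Integrable (symmIntegrand α u x)) : FracLaplacianExists α u x := by
  refine ⟨fun r hr => integrableOn_fracIntegrand hα0 hu hM x hr, ?_⟩
  rw [fracLaplacian_eq hα0 hu hM hint]
  exact tendsto_fracLaplacianTrunc hα0 hu hM hint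

/-! ### Tiling the quadrant by grid cells and the far region -/

/-- The half-open cell `[i h, (i+1) h) × [j h, (j+1) h)`. -/
def gridCell (h : ℝ) (i j : ℕ) : Set Plane :=
  {ξ | ξ 0 ∈ Ico (i * h) ((i + 1) * h) ∧ ξ 1 ∈ Ico (j * h) ((j + 1) * h)}

/-- The half-open square `[0, L)²`. -/
def halfOpenSquare (L : ℝ) : Set Plane := {ξ | ξ 0 ∈ Ico 0 L ∧ ξ 1 ∈ Ico 0 L}

theorem measurableSet_coord_prod {s t : Set ℝ} (hs : MeasurableSet s) (ht : MeasurableSet t) :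
    MeasurableSet {ξ : Plane | ξ 0 ∈ s ∧ ξ 1 ∈ t} :=
  (measurable_coord 0 hs).inter (measurable_coord 1 ht)

theorem isBounded_of_coord_mem_Icc {s : Set Plane} {a b a' b' : ℝ}
    (hs : ∀ ξ ∈ s, ξ 0 ∈ Icc a b ∧ ξ 1 ∈ Icc a' b') : Bornology.IsBounded s := by
  refine isBounded_iff_forall_norm_le.2 ⟨max |a| |b| + max |a'| |b'|, fun ξ hξ => ?_⟩
  obtain ⟨⟨h1, h2⟩, h3, h4⟩ := hs ξ hξ
  exact (Plane.norm_le ξ).trans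
    (add_le_add (abs_le_max_abs_abs h1 h2) (abs_le_max_abs_abs h3 h4))

theorem measurableSet_gridElement (h : ℝ) (i j : ℕ) : MeasurableSet (gridElement h i j) :=
  measurableSet_coord_prod measurableSet_Icc measurableSet_Icc

theorem measurableSet_gridCell (h : ℝ) (i j : ℕ) : MeasurableSet (gridCell h i j) :=
  measurableSet_coord_prod measurableSet_Ico measurableSet_Ico

theorem isBounded_gridElement (h : ℝ) (i j : ℕ) : Bornology.IsBounded (gridElement h i j) :=
  isBounded_of_coord_mem_Icc fun _ hξ => hξ

theorem isBounded_halfOpenSquare (L : ℝ) : Bornology.IsBounded (halfOpenSquare L) :=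
  isBounded_of_coord_mem_Icc fun _ hξ => ⟨Ico_subset_Icc_self hξ.1, Ico_subset_Icc_self hξ.2⟩

theorem isCompact_gridElement (h : ℝ) (i j : ℕ) : IsCompact (gridElement h i j) := by
  refine Metric.isCompact_of_isClosed_isBounded ?_ (isBounded_gridElement h i j)
  exact (isClosed_Icc.preimage (by fun_prop : Continuous fun ξ : Plane => ξ 0)).inter
    (isClosed_Icc.preimage (by fun_prop : Continuous fun ξ : Plane => ξ 1))

theorem ae_coord_ne (i : Fin 2) (a : ℝ) : ∀ᵐ ξ : Plane, ξ i ≠ a := by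
  rw [ae_iff]; simpa using volume_coord_eq i a

/-- The closed elements of the scheme overlap along edges; the half-open cells are disjoint and have
the same integrals. -/
theorem gridElement_ae_eq (h : ℝ) (i j : ℕ) :
    (gridElement h i j : Set Plane) =ᵐ[volume] (gridCell h i j : Set Plane) := by
  filter_upwards [ae_coord_ne 0 ((i + 1) * h), ae_coord_ne 1 ((j + 1) * h)] with ξ h0 h1
  apply propext
  change (_ ∈ Icc _ _ ∧ _ ∈ Icc _ _) ↔ (_ ∈ Ico _ _ ∧ _ ∈ Ico _ _)
  exact ⟨fun H => ⟨⟨H.1.1, lt_of_le_of_ne H.1.2 h0⟩, ⟨H.2.1, lt_of_le_of_ne H.2.2 h1⟩⟩,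
    fun H => ⟨Ico_subset_Icc_self H.1, Ico_subset_Icc_self H.2⟩⟩

theorem natCell_unique {h t : ℝ} {i i' : ℕ} (hh : 0 < h)
    (h1 : t ∈ Ico (i * h) ((i + 1) * h)) (h2 : t ∈ Ico (i' * h) ((i' + 1) * h)) : i = i' := by
  have a1 : (i : ℝ) < i' + 1 := lt_of_mul_lt_mul_right (h1.1.trans_lt h2.2) hh.le
  have a2 : (i' : ℝ) < i + 1 := lt_of_mul_lt_mul_right (h2.1.trans_lt h1.2) hh.le
  norm_cast at a1 a2
  omega

theorem exists_natCell {h t : ℝ} {N : ℕ} (hh : 0 < h) (ht : t ∈ Ico 0 (N * h)) :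
    ∃ i < N, t ∈ Ico (i * h) ((i + 1) * h) := by
  refine ⟨⌊t / h⌋₊, ?_, ?_, ?_⟩
  · rw [Nat.floor_lt (div_nonneg ht.1 hh.le), div_lt_iff₀ hh]
    exact ht.2
  · rw [← le_div_iff₀ hh]
    exact Nat.floor_le (div_nonneg ht.1 hh.le)
  · rw [← div_lt_iff₀ hh]
    exact Nat.lt_floor_add_one _

theorem biUnion_gridCell {h : ℝ} (hh : 0 < h) (N : ℕ) :
    ⋃ p ∈ Finset.range N ×ˢ Finset.range N, gridCell h p.1 p.2 = halfOpenSquare (N * h) := by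
  have hsub : ∀ i < N, Ico ((i : ℝ) * h) ((i + 1) * h) ⊆ Ico 0 (N * h) := fun i hi => by
    have : (i : ℝ) + 1 ≤ N := by exact_mod_cast hi
    exact Ico_subset_Ico (by positivity) (by gcongr)
  ext ξ
  simp only [mem_iUnion, Finset.mem_product, Finset.mem_range]
  constructor
  · rintro ⟨p, ⟨h1, h2⟩, H⟩
    exact ⟨hsub _ h1 H.1, hsub _ h2 H.2⟩
  · rintro ⟨H1, H2⟩
    obtain ⟨i, hi, hi'⟩ := exists_natCell hh H1
    obtain ⟨j, hj, hj'⟩ := exists_natCell hh H2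
    exact ⟨(i, j), ⟨hi, hj⟩, hi', hj'⟩

theorem sum_setIntegral_gridElement {h : ℝ} (hh : 0 < h) (N : ℕ) {F : Plane → ℝ}
    (hF : IntegrableOn F (halfOpenSquare (N * h))) :
    ∑ i ∈ Finset.range N, ∑ j ∈ Finset.range N, ∫ ξ in gridElement h i j, F ξ =
      ∫ ξ in halfOpenSquare (N * h), F ξ := by
  rw [← biUnion_gridCell hh N] at hF ⊢
  rw [integral_biUnion_finset _ (fun p _ => measurableSet_gridCell h p.1 p.2), Finset.sum_product]
  · exact Finset.sum_congr rfl fun i _ => Finset.sum_congr rfl fun j _ =>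
      setIntegral_congr_set (gridElement_ae_eq h i j)
  · intro p _ q _ hpq
    refine disjoint_left.2 fun ξ h1 h2 => hpq ?_
    exact Prod.ext (natCell_unique hh h1.1 h2.1) (natCell_unique hh h1.2 h2.2)
  · exact fun p hp => hF.mono_set (subset_biUnion_of_mem (u := fun p : ℕ × ℕ =>
      gridCell h p.1 p.2) hp)

theorem measurableSet_farRegion (L : ℝ) : MeasurableSet (farRegion L) :=
  (measurableSet_lt measurable_const (measurable_coord 0)).inter
    ((measurableSet_lt measurable_const (measurable_coord 1)).inter
      ((measurableSet_le measurable_const (measurable_coord 0)).union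
        (measurableSet_le measurable_const (measurable_coord 1))))

theorem setIntegral_firstQuadrant_eq {L : ℝ} {F : Plane → ℝ} (hF : Integrable F) :
    ∫ ξ in firstQuadrant, F ξ =
      (∫ ξ in halfOpenSquare L, F ξ) + ∫ ξ in farRegion L, F ξ := by
  have hae : (firstQuadrant : Set Plane) =ᵐ[volume]
      (halfOpenSquare L ∪ farRegion L : Set Plane) := by
    filter_upwards [ae_coord_ne 0 0, ae_coord_ne 1 0] with ξ h0 h1
    apply propext
    change (0 < ξ 0 ∧ 0 < ξ 1) ↔
      ((ξ 0 ∈ Ico 0 L ∧ ξ 1 ∈ Ico 0 L) ∨ (0 < ξ 0 ∧ 0 < ξ 1 ∧ (L ≤ ξ 0 ∨ L ≤ ξ 1)))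
    constructor
    · rintro ⟨a, b⟩
      by_cases hL : L ≤ ξ 0 ∨ L ≤ ξ 1
      · exact Or.inr ⟨a, b, hL⟩
      · push Not at hL
        exact Or.inl ⟨⟨a.le, hL.1⟩, ⟨b.le, hL.2⟩⟩
    · rintro (⟨a, b⟩ | ⟨a, b, -⟩)
      · exact ⟨lt_of_le_of_ne a.1 h0.symm, lt_of_le_of_ne b.1 h1.symm⟩
      · exact ⟨a, b⟩
  rw [setIntegral_congr_set hae, setIntegral_union _ (measurableSet_farRegion L) hF.integrableOn hF.integrableOn]
  refine disjoint_left.2 fun ξ h1 h2 => ?_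
  rcases h2.2.2 with h | h
  · exact absurd h (not_le.2 h1.1.2)
  · exact absurd h (not_le.2 h1.2.2)

/-! ### Errors on cells and their cancellation under the coordinate swap -/

/-- The average over the vertices of the element `I_{ij}`; at the origin, the average over
`ξ_{10}` and `ξ_{01}`. -/
def vertexAvg (f : Plane → ℝ) (h : ℝ) (i j : ℕ) : ℝ :=
  if i = 0 ∧ j = 0 then (f (gridPoint h 1 0) + f (gridPoint h 0 1)) / 2
  else (f (gridPoint h i j) + f (gridPoint h i (j + 1)) + f (gridPoint h (i + 1) j) +
    f (gridPoint h (i + 1) (j + 1))) / 4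

/-- The error of the weighted trapezoidal rule for `f` on the element `I_{ij}`. -/
def cellError (α : ℝ) (f : Plane → ℝ) (h : ℝ) (i j : ℕ) : ℝ :=
  vertexAvg f h i j * (∫ ξ in gridElement h i j, quadWeight 2 α ξ) -
    ∫ ξ in gridElement h i j, f ξ * quadWeight 2 α ξ

theorem elementQuad_two_eq (α h : ℝ) (u : Plane → ℝ) (x : Plane) (i j : ℕ) :
    elementQuad 2 α h u x i j =
      vertexAvg (centralQuot 2 u x) h i j * ∫ ξ in gridElement h i j, quadWeight 2 α ξ := by
  rw [elementQuad, vertexAvg]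
  congr 1
  split_ifs
  · simp [originCoeff]; ring
  · simp [Finset.sum_range_succ]; ring

theorem vertexAvg_add (f g : Plane → ℝ) (h : ℝ) (i j : ℕ) :
    vertexAvg (fun ξ => f ξ + g ξ) h i j = vertexAvg f h i j + vertexAvg g h i j := by
  simp only [vertexAvg]; split_ifs <;> ring

theorem swapCoord_gridPoint (h : ℝ) (i j : ℕ) :
    swapCoord (gridPoint h i j) = gridPoint h j i := by
  ext k; fin_cases k
  · exact (swapCoord_apply_zero _).trans (by simp [gridPoint])
  · exact (swapCoord_apply_one _).trans (by simp [gridPoint])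

theorem vertexAvg_comp_swap (f : Plane → ℝ) (h : ℝ) (i j : ℕ) :
    vertexAvg (fun ξ => f (swapCoord ξ)) h i j = vertexAvg f h j i := by
  simp only [vertexAvg, swapCoord_gridPoint, and_comm (a := i = 0)]
  split_ifs <;> ring

theorem gridPoint_ne_zero {h : ℝ} (hh : 0 < h) {i j : ℕ} (hij : ¬ (i = 0 ∧ j = 0)) :
    gridPoint h i j ≠ 0 := by
  intro H
  apply hij
  have h0 : gridPoint h i j 0 = 0 := by rw [H]; rfl
  have h1 : gridPoint h i j 1 = 0 := by rw [H]; rfl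
  simpa [gridPoint, hh.ne'] using And.intro h0 h1

/-- The rule never evaluates at the origin, so the value there, where the quotient is 0 by division
by zero, is irrelevant. -/
theorem vertexAvg_eq_of_ne_zero {f : Plane → ℝ} {c h : ℝ} (hh : 0 < h)
    (hf : ∀ ξ, ξ ≠ 0 → f ξ = c) (i j : ℕ) : vertexAvg f h i j = c := by
  rw [vertexAvg]
  split_ifs with hij
  · rw [hf _ (gridPoint_ne_zero hh (by simp)), hf _ (gridPoint_ne_zero hh (by simp))]; ring
  · rw [hf _ (gridPoint_ne_zero hh hij), hf _ (gridPoint_ne_zero hh (by simp)),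
      hf _ (gridPoint_ne_zero hh (by simp)), hf _ (gridPoint_ne_zero hh (by simp))]
    ring

theorem cellError_add {α : ℝ} {f g : Plane → ℝ} {h : ℝ} {i j : ℕ}
    (hf : IntegrableOn (fun ξ => f ξ * quadWeight 2 α ξ) (gridElement h i j))
    (hg : IntegrableOn (fun ξ => g ξ * quadWeight 2 α ξ) (gridElement h i j)) :
    cellError α (fun ξ => f ξ + g ξ) h i j = cellError α f h i j + cellError α g h i j := by
  simp only [cellError, vertexAvg_add, add_mul]
  rw [integral_add hf hg]
  ring

theorem preimage_swapCoord_gridElement (h : ℝ) (i j : ℕ) :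
    swapCoord ⁻¹' gridElement h i j = gridElement h j i := by
  ext ξ
  simp only [gridElement, mem_preimage, mem_ofPred_eq, swapCoord_apply_zero, swapCoord_apply_one]
  exact and_comm

theorem quadWeight_isometry (γ α : ℝ) (e : Plane ≃ₗᵢ[ℝ] Plane) (ξ : Plane) :
    quadWeight γ α (e ξ) = quadWeight γ α ξ := by
  rw [quadWeight, quadWeight, e.norm_map]

theorem cellError_comp_swap (α : ℝ) (f : Plane → ℝ) (h : ℝ) (i j : ℕ) :
    cellError α (fun ξ => f (swapCoord ξ)) h i j = cellError α f h j i := by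
  have := fun F : Plane → ℝ => setIntegral_comp_isometry swapCoord F (gridElement h j i)
  simp only [preimage_swapCoord_gridElement] at this
  simp only [cellError, vertexAvg_comp_swap]
  rw [← this (fun ξ => f ξ * quadWeight 2 α ξ), ← this (quadWeight 2 α)]
  simp only [quadWeight_isometry]

theorem cellError_eq_zero_of_const {α : ℝ} {f : Plane → ℝ} {c h : ℝ} (hh : 0 < h)
    (hf : ∀ ξ, ξ ≠ 0 → f ξ = c) (i j : ℕ) : cellError α f h i j = 0 := by
  have h0 : ∀ᵐ ξ : Plane, ξ ≠ 0 := by simp [ae_iff]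
  rw [cellError, vertexAvg_eq_of_ne_zero hh hf, ← integral_const_mul, sub_eq_zero]
  refine integral_congr_ae (ae_restrict_of_ae ?_)
  filter_upwards [h0] with ξ hξ
  rw [hf ξ hξ]

/-- The rule integrates over the whole square exactly every `f` whose symmetrization in the two
coordinates is constant. -/
theorem sum_cellError_eq_zero {α : ℝ} {f : Plane → ℝ} {c h : ℝ} (hh : 0 < h)
    (hf : ∀ ξ, ξ ≠ 0 → f ξ + f (swapCoord ξ) = c)
    (hint : ∀ i j, IntegrableOn (fun ξ => f ξ * quadWeight 2 α ξ) (gridElement h i j)) (N : ℕ) :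
    ∑ i ∈ Finset.range N, ∑ j ∈ Finset.range N, cellError α f h i j = 0 := by
  -- The error on I_{ji} is the error on I_{ij} of f composed with the swap, so the two add up to
  -- the error for a constant.
  have key : ∀ i j, cellError α f h i j + cellError α f h j i = 0 := fun i j => by
    have h2 : IntegrableOn (fun ξ => f (swapCoord ξ) * quadWeight 2 α ξ) (gridElement h i j) := by
      have := (integrableOn_comp_isometry swapCoord).2 (hint j i)
      simpa only [preimage_swapCoord_gridElement, quadWeight_isometry] using this
    rw [← cellError_comp_swap α f h i j, ← cellError_add (hint i j) h2]
    exact cellError_eq_zero_of_const hh hf i j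
  have hs : ∑ i ∈ Finset.range N, ∑ j ∈ Finset.range N, cellError α f h i j =
      ∑ i ∈ Finset.range N, ∑ j ∈ Finset.range N, cellError α f h j i := Finset.sum_comm
  have : ∑ i ∈ Finset.range N, ∑ j ∈ Finset.range N, cellError α f h i j +
      ∑ i ∈ Finset.range N, ∑ j ∈ Finset.range N, cellError α f h j i = 0 := by
    simp only [← Finset.sum_add_distrib, key, Finset.sum_const_zero]
  linarith

theorem integrableOn_mul_quadWeight {α : ℝ} (hα : α < 2) {f : Plane → ℝ} (hf : Measurable f)
    {s : Set Plane} (hs : Bornology.IsBounded s) (hsm : MeasurableSet s) {B : ℝ}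
    (hB : ∀ ξ ∈ s, |f ξ| ≤ B) : IntegrableOn (fun ξ => f ξ * quadWeight 2 α ξ) s := by
  refine Integrable.mono' ((integrableOn_norm_rpow_of_isBounded (a := 2 - (2 + α)) (by linarith)
    hs).const_mul B) (hf.mul (measurable_norm.pow_const _)).aestronglyMeasurable
    ((ae_restrict_iff' hsm).2 (ae_of_all _ fun ξ hξ => ?_))
  rw [quadWeight, norm_mul, Real.norm_eq_abs, Real.norm_of_nonneg (r := ‖ξ‖ ^ _) (by positivity)]
  gcongr
  exact hB ξ hξ

/-! ### The weighted trapezoidal rule on one cell -/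

/-- The centre of the element `I_{ij}`. -/
def cellCenter (h : ℝ) (i j : ℕ) : Plane := !₂[(i + 1 / 2) * h, (j + 1 / 2) * h]

theorem cellCenter_zero (h : ℝ) (i j : ℕ) : cellCenter h i j 0 = (i + 1 / 2) * h := by
  simp [cellCenter]

theorem cellCenter_one (h : ℝ) (i j : ℕ) : cellCenter h i j 1 = (j + 1 / 2) * h := by
  simp [cellCenter]

theorem mem_gridElement {h : ℝ} {i j : ℕ} {ξ : Plane} :
    ξ ∈ gridElement h i j ↔
      (i * h ≤ ξ 0 ∧ ξ 0 ≤ (i + 1) * h) ∧ (j * h ≤ ξ 1 ∧ ξ 1 ≤ (j + 1) * h) := Iff.rfl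

theorem norm_sub_cellCenter_le {h : ℝ} {i j : ℕ} {ξ : Plane} (hξ : ξ ∈ gridElement h i j) :
    ‖ξ - cellCenter h i j‖ ≤ h := by
  rw [mem_gridElement] at hξ
  refine (Plane.norm_le _).trans ?_
  simp only [PiLp.sub_apply, cellCenter_zero, cellCenter_one]
  have h0 : |ξ 0 - (i + 1 / 2) * h| ≤ h / 2 := abs_le.2 ⟨by linarith [hξ.1.1], by linarith [hξ.1.2]⟩
  have h1 : |ξ 1 - (j + 1 / 2) * h| ≤ h / 2 := abs_le.2 ⟨by linarith [hξ.2.1], by linarith [hξ.2.2]⟩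
  linarith

theorem reflect_cellCenter_mem {h : ℝ} {i j : ℕ} {ξ : Plane} :
    (2 : ℝ) • cellCenter h i j - ξ ∈ gridElement h i j ↔ ξ ∈ gridElement h i j := by
  simp only [mem_gridElement, PiLp.sub_apply, PiLp.smul_apply, cellCenter_zero, cellCenter_one,
    smul_eq_mul]
  constructor
  · rintro ⟨⟨a, b⟩, c, d⟩
    exact ⟨⟨by linarith, by linarith⟩, by linarith, by linarith⟩
  · rintro ⟨⟨a, b⟩, c, d⟩
    exact ⟨⟨by linarith, by linarith⟩, by linarith, by linarith⟩

theorem cellCenter_mem {h : ℝ} (hh : 0 ≤ h) (i j : ℕ) : cellCenter h i j ∈ gridElement h i j := by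
  simp only [mem_gridElement, cellCenter_zero, cellCenter_one]
  exact ⟨⟨by linarith, by linarith⟩, by linarith, by linarith⟩

theorem gridPoint_mem {h : ℝ} (hh : 0 ≤ h) {i j k l : ℕ} (hk : i ≤ k ∧ k ≤ i + 1)
    (hl : j ≤ l ∧ l ≤ j + 1) : gridPoint h k l ∈ gridElement h i j := by
  have e0 : gridPoint h k l 0 = k * h := by simp [gridPoint]
  have e1 : gridPoint h k l 1 = l * h := by simp [gridPoint]
  have h1 : (i : ℝ) ≤ k := by exact_mod_cast hk.1
  have h2 : (k : ℝ) ≤ i + 1 := by exact_mod_cast hk.2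
  have h3 : (j : ℝ) ≤ l := by exact_mod_cast hl.1
  have h4 : (l : ℝ) ≤ j + 1 := by exact_mod_cast hl.2
  rw [mem_gridElement, e0, e1]
  exact ⟨⟨by gcongr, by gcongr⟩, by gcongr, by gcongr⟩

theorem setIntegral_reflect_cellCenter (f : Plane → ℝ) (h : ℝ) (i j : ℕ) :
    ∫ ξ in gridElement h i j, f ((2 : ℝ) • cellCenter h i j - ξ) =
      ∫ ξ in gridElement h i j, f ξ := by
  have := (Measure.measurePreserving_sub_left volume ((2 : ℝ) • cellCenter h i j)).setIntegral_preimage_emb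
    (MeasurableEquiv.subLeft ((2 : ℝ) • cellCenter h i j)).measurableEmbedding f (gridElement h i j)
  rwa [show (fun ξ => (2 : ℝ) • cellCenter h i j - ξ) ⁻¹' gridElement h i j = gridElement h i j from
    ext fun ξ => reflect_cellCenter_mem] at this

/-- The trapezoidal rule with a weight `ω` on an element away from the origin. -/
theorem abs_trapezoid_error_le {f ω g : Plane → ℝ} {h A B W w : ℝ} {i j : ℕ} (hh : 0 < h)
    (hij : ¬ (i = 0 ∧ j = 0)) (hA0 : 0 ≤ A) (hB0 : 0 ≤ B)
    (hA : ∀ a ∈ gridElement h i j, ∀ b ∈ gridElement h i j, |f a - f b| ≤ A * ‖a - b‖)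
    (hB : ∀ a ∈ gridElement h i j, |f a + f ((2 : ℝ) • cellCenter h i j - a) -
      2 * f (cellCenter h i j)| ≤ B * ‖a - cellCenter h i j‖ ^ 2)
    (hW0 : 0 ≤ W)
    (hW : ∀ a ∈ gridElement h i j, ∀ b ∈ gridElement h i j, |ω a - ω b| ≤ W * ‖a - b‖)
    (hw : |ω (cellCenter h i j)| ≤ w)
    (hg : IntegrableOn g (gridElement h i j))
    (hle : ∀ ξ ∈ gridElement h i j, (2 * A * W + B * w) * h ^ 2 ≤ g ξ) :
    |vertexAvg f h i j * (∫ ξ in gridElement h i j, ω ξ) - ∫ ξ in gridElement h i j, f ξ * ω ξ| ≤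
      ∫ ξ in gridElement h i j, g ξ := by
  set I := gridElement h i j with hI
  set c := cellCenter h i j with hc
  set q := vertexAvg f h i j with hq
  have hcI : c ∈ I := cellCenter_mem hh.le i j
  have hcont : ∀ {F : Plane → ℝ} {k : ℝ}, 0 ≤ k →
      (∀ a ∈ I, ∀ b ∈ I, |F a - F b| ≤ k * ‖a - b‖) → ContinuousOn F I := fun {F k} hk hF => by
    refine (LipschitzOnWith.of_dist_le_mul (K := ⟨k, hk⟩) fun a ha b hb => ?_).continuousOn
    rw [Real.dist_eq, dist_eq_norm]
    exact hF a ha b hb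
  have hfc := hcont hA0 hA
  have hωc := hcont hW0 hW
  have hrefl : ContinuousOn (fun ξ => f ((2 : ℝ) • c - ξ)) I :=
    hfc.comp (by fun_prop) fun ξ hξ => reflect_cellCenter_mem.2 hξ
  have hK : IsCompact I := isCompact_gridElement h i j
  have hIm : MeasurableSet I := measurableSet_gridElement h i j
  have int : ∀ {F : Plane → ℝ}, ContinuousOn F I → IntegrableOn F I := fun hF =>
    hF.integrableOn_compact hK
  have hdist : ∀ a ∈ I, ‖a - c‖ ≤ h := fun a ha => norm_sub_cellCenter_le ha
  have hB' : ∀ a ∈ I, |f a + f ((2 : ℝ) • c - a) - 2 * f c| ≤ B * h ^ 2 := fun a ha =>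
    (hB a ha).trans (by gcongr; exact hdist a ha)
  -- The four vertices form two pairs opposite with respect to the centre, so the symmetric second
  -- difference bound applies to each pair.
  have hqc : |q - f c| ≤ B * h ^ 2 / 2 := by
    have e1 : gridPoint h (i + 1) (j + 1) = (2 : ℝ) • c - gridPoint h i j := by
      ext k; fin_cases k <;> simp [gridPoint, hc, cellCenter] <;> ring
    have e2 : gridPoint h (i + 1) j = (2 : ℝ) • c - gridPoint h i (j + 1) := by
      ext k; fin_cases k <;> simp [gridPoint, hc, cellCenter] <;> ring
    have b1 := hB' _ (gridPoint_mem (i := i) (j := j) (k := i) (l := j) hh.le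
      ⟨le_rfl, by omega⟩ ⟨le_rfl, by omega⟩)
    have b2 := hB' _ (gridPoint_mem (i := i) (j := j) (k := i) (l := j + 1) hh.le
      ⟨le_rfl, by omega⟩ ⟨by omega, le_rfl⟩)
    rw [hq, vertexAvg, if_neg hij, e1, e2]
    rw [abs_le] at b1 b2 ⊢
    constructor <;> linarith [b1.1, b1.2, b2.1, b2.2]
  have hqA : ∀ a ∈ I, |q - f a| ≤ 2 * A * h := fun a ha => by
    have m := fun k l hk hl => hA _ (gridPoint_mem (i := i) (j := j) (k := k) (l := l) hh.le hk hl)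
      c hcI
    have d := fun k l hk hl => hdist _
      (gridPoint_mem (i := i) (j := j) (k := k) (l := l) hh.le hk hl)
    have md : ∀ k l, i ≤ k ∧ k ≤ i + 1 → j ≤ l ∧ l ≤ j + 1 →
        |f (gridPoint h k l) - f c| ≤ A * h := fun k l hk hl =>
      (m k l hk hl).trans (by gcongr; exact d k l hk hl)
    have b1 := md i j (by omega) (by omega)
    have b2 := md i (j + 1) (by omega) (by omega)
    have b3 := md (i + 1) j (by omega) (by omega)
    have b4 := md (i + 1) (j + 1) (by omega) (by omega)
    have b5 : |f a - f c| ≤ A * h := (hA a ha c hcI).trans (by gcongr; exact hdist a ha)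
    rw [hq, vertexAvg, if_neg hij]
    rw [abs_le] at b1 b2 b3 b4 b5 ⊢
    constructor <;> linarith [b1.1, b1.2, b2.1, b2.2, b3.1, b3.2, b4.1, b4.2, b5.1, b5.2]
  -- Freeze the weight at the centre. The fluctuation of ω multiplies a first-order error of f; in
  -- the frozen term f may be replaced by its average with its reflection through the centre, which
  -- turns that error into second order.
  have hsplit : q * (∫ ξ in I, ω ξ) - ∫ ξ in I, f ξ * ω ξ =
      ∫ ξ in I, ((q - f ξ) * (ω ξ - ω c) + ω c * (q - (f ξ + f ((2 : ℝ) • c - ξ)) / 2)) := by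
    obtain ⟨f', hf'⟩ : ∃ F : Plane → ℝ, F = fun ξ => f ((2 : ℝ) • c - ξ) := ⟨_, rfl⟩
    have e : ∀ ξ, f ((2 : ℝ) • c - ξ) = f' ξ := fun ξ => by rw [hf']
    have hfi : ∫ ξ in I, f' ξ = ∫ ξ in I, f ξ := by
      rw [hf']; exact setIntegral_reflect_cellCenter f h i j
    rw [← hf'] at hrefl
    simp only [e]
    have i1 : IntegrableOn (fun ξ => (q - f ξ) * (ω ξ - ω c)) I := int (by fun_prop)
    have i2 : IntegrableOn (fun ξ => ω c * (q - (f ξ + f' ξ) / 2)) I := int (by fun_prop)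
    have i3 : IntegrableOn (fun ξ => f ξ / 2 + f' ξ / 2) I := int (by fun_prop)
    have i4 : IntegrableOn (fun ξ => ω c * (q - f ξ)) I := int (by fun_prop)
    have iq : IntegrableOn (fun _ => q) I := int (by fun_prop)
    have hr : ∫ ξ in I, (q - (f ξ + f' ξ) / 2) = ∫ ξ in I, (q - f ξ) := by
      simp only [add_div]
      rw [integral_sub iq i3, integral_add (int (by fun_prop)) (int (by fun_prop)),
        integral_sub iq (int hfc), integral_div, integral_div, hfi]
      ring
    rw [integral_add i1 i2, integral_const_mul, hr, ← integral_const_mul (ω c), ← integral_add i1 i4,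
      ← integral_const_mul q, ← integral_sub (int (by fun_prop)) (int (by fun_prop))]
    congr 1
    ext ξ
    ring
  rw [hsplit, ← Real.norm_eq_abs]
  refine norm_integral_le_of_norm_le hg ((ae_restrict_iff' hIm).2 (ae_of_all _ fun ξ hξ => ?_))
  refine le_trans ?_ (hle ξ hξ)
  rw [Real.norm_eq_abs]
  have b1 : |(q - f ξ) * (ω ξ - ω c)| ≤ (2 * A * h) * (W * h) := by
    rw [abs_mul]
    gcongr
    · exact hqA ξ hξ
    · exact (hW ξ hξ c hcI).trans (by gcongr; exact hdist ξ hξ)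
  have b2 : |ω c * (q - (f ξ + f ((2 : ℝ) • c - ξ)) / 2)| ≤ w * (B * h ^ 2) := by
    rw [abs_mul]
    have : |q - (f ξ + f ((2 : ℝ) • c - ξ)) / 2| ≤ B * h ^ 2 := by
      have b := hB' ξ hξ
      rw [abs_le] at b hqc ⊢
      constructor <;> linarith [b.1, b.2, hqc.1, hqc.2]
    gcongr
    exact (abs_nonneg _).trans hw
  calc _ ≤ _ := abs_add_le _ _
    _ ≤ (2 * A * h) * (W * h) + w * (B * h ^ 2) := add_le_add b1 b2
    _ = _ := by ring

/-! ### Finite differences of negative powers of the norm and of quotients -/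

/-- The first difference of `ξ ↦ |ξ|⁻²`. -/
theorem abs_inv_norm_sq_sub_le {E : Type*} [NormedAddCommGroup E] {M : ℝ} (hM : 0 < M) {a b : E}
    (ha : M ≤ ‖a‖) (hb : M ≤ ‖b‖) (ha' : ‖a‖ ≤ 3 * M) (hb' : ‖b‖ ≤ 3 * M) :
    |(‖a‖ ^ 2)⁻¹ - (‖b‖ ^ 2)⁻¹| ≤ 6 / M ^ 3 * ‖a - b‖ := by
  have ha0 : 0 < ‖a‖ := hM.trans_le ha
  have hb0 : 0 < ‖b‖ := hM.trans_le hb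
  have e : (‖a‖ ^ 2)⁻¹ - (‖b‖ ^ 2)⁻¹ =
      ((‖b‖ + ‖a‖) / (‖a‖ ^ 2 * ‖b‖ ^ 2)) * (‖b‖ - ‖a‖) := by
    field_simp
    ring
  rw [e, abs_mul, abs_of_nonneg (by positivity)]
  refine mul_le_mul ?_ ?_ (abs_nonneg _) (by positivity)
  · calc (‖b‖ + ‖a‖) / (‖a‖ ^ 2 * ‖b‖ ^ 2) ≤ (3 * M + 3 * M) / (M ^ 2 * M ^ 2) := by gcongr
      _ = 6 / M ^ 3 := by field_simp; ring
  · rw [abs_sub_comm]; exact abs_norm_sub_norm_le a b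

/-- The symmetric second difference of `ξ ↦ |ξ|⁻²`. -/
theorem abs_inv_norm_sq_symm_diff_le {E : Type*} [NormedAddCommGroup E] [InnerProductSpace ℝ E]
    {M : ℝ} (hM : 0 < M) {c t : E} (hc : M ≤ ‖c‖) (hp : M ≤ ‖c + t‖) (hm : M ≤ ‖c - t‖)
    (hp' : ‖c + t‖ ≤ 3 * M) (hm' : ‖c - t‖ ≤ 3 * M) (hc' : ‖c‖ ≤ 3 * M) :
    |(‖c + t‖ ^ 2)⁻¹ + (‖c - t‖ ^ 2)⁻¹ - 2 * (‖c‖ ^ 2)⁻¹| ≤ 72 / M ^ 4 * ‖t‖ ^ 2 := by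
  have e1 := norm_add_sq_real c t
  have e2 := norm_sub_sq_real c t
  have hs := abs_real_inner_le_norm c t
  have hs2 : inner ℝ c t ^ 2 ≤ ‖c‖ ^ 2 * ‖t‖ ^ 2 := by
    rw [← sq_abs, ← mul_pow]; gcongr
  have q1 : M ^ 2 ≤ ‖c‖ ^ 2 := by gcongr
  have q2 : M ^ 2 ≤ ‖c + t‖ ^ 2 := by gcongr
  have q3 : M ^ 2 ≤ ‖c - t‖ ^ 2 := by gcongr
  have r1 : ‖c‖ ^ 2 ≤ 9 * M ^ 2 := by
    calc ‖c‖ ^ 2 ≤ (3 * M) ^ 2 := by gcongr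
      _ = _ := by ring
  have r2 : ‖c + t‖ ^ 2 ≤ 9 * M ^ 2 := by
    calc ‖c + t‖ ^ 2 ≤ (3 * M) ^ 2 := by gcongr
      _ = _ := by ring
  have r3 : ‖c - t‖ ^ 2 ≤ 9 * M ^ 2 := by
    calc ‖c - t‖ ^ 2 ≤ (3 * M) ^ 2 := by gcongr
      _ = _ := by ring
  have hq0 : 0 ≤ ‖t‖ ^ 2 := by positivity
  have hM2 : 0 < M ^ 2 := by positivity
  have hM4 : 72 / M ^ 4 = 72 / (M ^ 2) ^ 2 := by ring
  rw [hM4]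
  generalize ‖c + t‖ ^ 2 = P at *
  generalize ‖c - t‖ ^ 2 = Q at *
  generalize ‖c‖ ^ 2 = p at *
  generalize ‖t‖ ^ 2 = q at *
  generalize M ^ 2 = m at *
  generalize inner ℝ c t = s at *
  have hP : 0 < P := hM2.trans_le q2
  have hQ : 0 < Q := hM2.trans_le q3
  have hp0 : 0 < p := hM2.trans_le q1
  -- With P, Q = p + q ± 2s, the terms linear in s cancel, leaving a numerator of second order in t.
  have e : P⁻¹ + Q⁻¹ - 2 * p⁻¹ = 2 * (4 * s ^ 2 - q * (p + q)) / (p * P * Q) := by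
    field_simp
    rw [e1, e2]
    ring
  have hnum : |2 * (4 * s ^ 2 - q * (p + q))| ≤ 72 * m * q := by
    have : p + q ≤ 9 * m := by linarith
    have h1 : q * (p + q) ≤ q * (9 * m) := by gcongr
    have h2 : p * q ≤ 9 * m * q := by gcongr
    have h3 : 0 ≤ m * q := by positivity
    have h4 : 0 ≤ q * (p + q) := by positivity
    rw [abs_le]
    constructor <;> nlinarith [sq_nonneg s]
  rw [e, abs_div, abs_of_pos (by positivity : 0 < p * P * Q)]
  calc _ ≤ 72 * m * q / (m * m * m) := by gcongr
    _ = _ := by field_simp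

/-- The first difference of `ξ ↦ |ξ|^(-α)`. -/
theorem abs_norm_rpow_sub_le {E : Type*} [NormedAddCommGroup E] {M α : ℝ} (hα : 0 < α)
    (hM : 0 < M) {a b : E} (ha : M ≤ ‖a‖) (hb : M ≤ ‖b‖) :
    |‖a‖ ^ (-α) - ‖b‖ ^ (-α)| ≤ α * M ^ (-α - 1) * ‖a - b‖ := by
  have := (convex_Ici M).norm_image_sub_le_of_norm_hasDerivWithin_le
    (f := fun r : ℝ => r ^ (-α)) (f' := fun r => -α * r ^ (-α - 1)) (C := α * M ^ (-α - 1))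
    (fun r hr => (Real.hasDerivAt_rpow_const
      (Or.inl (hM.trans_le hr).ne')).hasDerivWithinAt)
    (fun r hr => by
      have hr0 : 0 < r := hM.trans_le hr
      rw [norm_mul, norm_neg, Real.norm_of_nonneg hα.le, Real.norm_of_nonneg (by positivity)]
      gcongr 1
      exact Real.rpow_le_rpow_of_nonpos hM hr (by linarith)) hb ha
  rw [Real.norm_eq_abs] at this
  refine this.trans ?_
  gcongr
  exact abs_norm_sub_norm_le a b

/-- First and symmetric second differences of `R / |ξ|²`. -/
theorem abs_div_norm_sq_diff_le {E : Type*} [NormedAddCommGroup E] [InnerProductSpace ℝ E]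
    {M κ : ℝ} (hM : 0 < M) (hκ : 0 ≤ κ) {R : E → ℝ}
    (h0 : ∀ η, ‖η‖ ≤ 3 * M → |R η| ≤ κ * (3 * M) ^ 2)
    (h1 : ∀ a b, ‖a‖ ≤ 3 * M → ‖b‖ ≤ 3 * M → |R a - R b| ≤ κ * (3 * M) * ‖a - b‖)
    (h2 : ∀ c t, ‖c + t‖ ≤ 3 * M → ‖c - t‖ ≤ 3 * M →
      |R (c + t) + R (c - t) - 2 * R c| ≤ 2 * κ * ‖t‖ ^ 2) :
    (∀ a b, M ≤ ‖a‖ → M ≤ ‖b‖ → ‖a‖ ≤ 3 * M → ‖b‖ ≤ 3 * M →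
      |R a / ‖a‖ ^ 2 - R b / ‖b‖ ^ 2| ≤ 57 * κ / M * ‖a - b‖) ∧
    ∀ c t, M ≤ ‖c‖ → M ≤ ‖c + t‖ → M ≤ ‖c - t‖ → ‖c‖ ≤ 3 * M → ‖c + t‖ ≤ 3 * M →
      ‖c - t‖ ≤ 3 * M → |R (c + t) / ‖c + t‖ ^ 2 + R (c - t) / ‖c - t‖ ^ 2 - 2 * (R c / ‖c‖ ^ 2)|
        ≤ 686 * κ / M ^ 2 * ‖t‖ ^ 2 := by
  have hG : ∀ a : E, M ≤ ‖a‖ → |(‖a‖ ^ 2)⁻¹| ≤ (M ^ 2)⁻¹ := fun a ha => by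
    rw [abs_of_nonneg (by positivity)]; gcongr
  constructor
  · intro a b ha hb ha' hb'
    have e : R a / ‖a‖ ^ 2 - R b / ‖b‖ ^ 2 =
        (R a - R b) * (‖a‖ ^ 2)⁻¹ + R b * ((‖a‖ ^ 2)⁻¹ - (‖b‖ ^ 2)⁻¹) := by ring
    rw [e]
    calc _ ≤ |R a - R b| * |(‖a‖ ^ 2)⁻¹| + |R b| * |(‖a‖ ^ 2)⁻¹ - (‖b‖ ^ 2)⁻¹| := by
          rw [← abs_mul, ← abs_mul]; exact abs_add_le _ _
      _ ≤ (κ * (3 * M) * ‖a - b‖) * (M ^ 2)⁻¹ + (κ * (3 * M) ^ 2) * (6 / M ^ 3 * ‖a - b‖) := by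
          gcongr
          · exact h1 a b ha' hb'
          · exact hG a ha
          · exact h0 b hb'
          · exact abs_inv_norm_sq_sub_le hM ha hb ha' hb'
      _ = _ := by field_simp; ring
  · intro c t hc hp hm hc' hp' hm'
    -- Discrete product rule for second differences; the four terms contribute 2 + 648 + 18 + 18 =
    -- 686.
    have e : R (c + t) / ‖c + t‖ ^ 2 + R (c - t) / ‖c - t‖ ^ 2 - 2 * (R c / ‖c‖ ^ 2) =
        (R (c + t) + R (c - t) - 2 * R c) * (‖c‖ ^ 2)⁻¹ +
        R c * ((‖c + t‖ ^ 2)⁻¹ + (‖c - t‖ ^ 2)⁻¹ - 2 * (‖c‖ ^ 2)⁻¹) +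
        (R (c + t) - R c) * ((‖c + t‖ ^ 2)⁻¹ - (‖c‖ ^ 2)⁻¹) +
        (R (c - t) - R c) * ((‖c - t‖ ^ 2)⁻¹ - (‖c‖ ^ 2)⁻¹) := by ring
    have t1 : ‖c + t - c‖ = ‖t‖ := by rw [add_sub_cancel_left]
    have t2 : ‖c - t - c‖ = ‖t‖ := by rw [sub_sub_cancel_left, norm_neg]
    have d1 := h1 _ _ hp' hc'
    have d2 := h1 _ _ hm' hc'
    have g1 := abs_inv_norm_sq_sub_le hM hp hc hp' hc'
    have g2 := abs_inv_norm_sq_sub_le hM hm hc hm' hc'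
    rw [t1] at d1 g1
    rw [t2] at d2 g2
    rw [e]
    refine (abs_add_le _ _).trans ((add_le_add_left (abs_add_le _ _) _).trans
      ((add_le_add_left (add_le_add_left (abs_add_le _ _) _) _).trans ?_))
    simp only [abs_mul]
    calc _ ≤ (2 * κ * ‖t‖ ^ 2) * (M ^ 2)⁻¹ + (κ * (3 * M) ^ 2) * (72 / M ^ 4 * ‖t‖ ^ 2) +
          (κ * (3 * M) * ‖t‖) * (6 / M ^ 3 * ‖t‖) +
          (κ * (3 * M) * ‖t‖) * (6 / M ^ 3 * ‖t‖) := by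
          gcongr
          · exact h2 c t hp' hm'
          · exact hG c hc
          · exact h0 c hc'
          · exact abs_inv_norm_sq_symm_diff_le hM hc hp hm hp' hm' hc'
      _ = _ := by field_simp; ring

theorem quadWeight_two (α : ℝ) (ξ : Plane) : quadWeight 2 α ξ = ‖ξ‖ ^ (-α) := by
  rw [quadWeight]; congr 1; ring

/-! ### Hessian part and remainder: error estimates -/

/-- The part of the four-point difference that comes from the Hessian at `x`. -/
def hessianPart (u : Plane → ℝ) (x ξ : Plane) : ℝ :=
  fderiv ℝ (fderiv ℝ u) x ξ ξ + fderiv ℝ (fderiv ℝ u) x (reflectCoord 1 ξ) (reflectCoord 1 ξ)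

/-- The remainder of the four-point difference. -/
def remainderPart (u : Plane → ℝ) (x ξ : Plane) : ℝ :=
  symmRemainder u x ξ + symmRemainder u x (reflectCoord 1 ξ)

theorem fourPointDiff_eq (u : Plane → ℝ) (x ξ : Plane) :
    fourPointDiff u x ξ = hessianPart u x ξ + remainderPart u x ξ := by
  simp only [fourPointDiff, hessianPart, remainderPart, symmRemainder]; ring

theorem abs_hessianPart_le (u : Plane → ℝ) (x ξ : Plane) :
    |hessianPart u x ξ| ≤ 2 * ‖fderiv ℝ (fderiv ℝ u) x‖ * ‖ξ‖ ^ 2 := by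
  have h := fun v : Plane => (fderiv ℝ (fderiv ℝ u) x).le_opNorm₂ v v
  have h1 := h ξ
  have h2 := h (reflectCoord 1 ξ)
  rw [LinearIsometryEquiv.norm_map] at h2
  rw [Real.norm_eq_abs] at h1 h2
  refine (abs_add_le _ _).trans ?_
  nlinarith [h1, h2]

theorem Plane.eq_smul_add_smul (ξ : Plane) :
    ξ = ξ 0 • EuclideanSpace.single 0 1 + ξ 1 • EuclideanSpace.single 1 1 := by
  ext j; fin_cases j <;> simp

/-- The reflection cancels the mixed term and doubles the squares; the swap exchanges the two pure
second derivatives, so both squares end with the coefficient 2Δu(x). -/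
theorem hessianPart_add_swap (u : Plane → ℝ) (x : Plane) :
    ∃ c, ∀ ξ, hessianPart u x ξ + hessianPart u x (swapCoord ξ) = c * ‖ξ‖ ^ 2 := by
  set B := fderiv ℝ (fderiv ℝ u) x with hB
  set e0 : Plane := EuclideanSpace.single 0 1
  set e1 : Plane := EuclideanSpace.single 1 1
  have hq : ∀ ξ : Plane, B ξ ξ = ξ 0 ^ 2 * B e0 e0 + ξ 0 * ξ 1 * (B e0 e1 + B e1 e0) +
      ξ 1 ^ 2 * B e1 e1 := fun ξ => by
    have e : B ξ ξ = B (ξ 0 • e0 + ξ 1 • e1) (ξ 0 • e0 + ξ 1 • e1) := by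
      rw [← Plane.eq_smul_add_smul]
    rw [e]
    simp only [map_add, map_smul, add_apply, smul_apply,
      smul_eq_mul]
    ring
  refine ⟨2 * (B e0 e0 + B e1 e1), fun ξ => ?_⟩
  simp only [hessianPart, ← hB]
  rw [hq, hq (reflectCoord 1 ξ), hq (swapCoord ξ), hq (reflectCoord 1 (swapCoord ξ)),
    Plane.norm_sq]
  simp only [reflectCoord_apply, swapCoord_apply_zero, swapCoord_apply_one]
  simp
  ring

theorem continuous_hessianPart (u : Plane → ℝ) (x : Plane) : Continuous (hessianPart u x) := by
  have := (reflectCoord 1).continuous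
  unfold hessianPart
  fun_prop

theorem continuous_remainderPart {u : Plane → ℝ} (hu : ContDiff ℝ 2 u) (x : Plane) :
    Continuous (remainderPart u x) := by
  have h : Continuous (symmRemainder u x) := continuous_iff_continuousAt.2 fun η =>
    (hasFDerivAt_symmRemainder hu x η).continuousAt
  exact h.add (h.comp (reflectCoord 1).continuous)

section Remainder

variable {u : Plane → ℝ} {x : Plane} {K α ε : ℝ}

theorem remainderPart_bounds (hu : ContDiff ℝ 2 u) (hK : 0 ≤ K) {β : ℝ} (hβ : 0 ≤ β)
    (h : ∀ η, ‖hessianSymmDiff u x η‖ ≤ K * ‖η‖ ^ β) {ρ : ℝ} (hρ : 0 ≤ ρ) :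
    (∀ η, ‖η‖ ≤ ρ → |remainderPart u x η| ≤ 2 * K * ρ ^ β * ρ ^ 2) ∧
    (∀ a b, ‖a‖ ≤ ρ → ‖b‖ ≤ ρ →
      |remainderPart u x a - remainderPart u x b| ≤ 2 * K * ρ ^ β * ρ * ‖a - b‖) ∧
    ∀ c t, ‖c + t‖ ≤ ρ → ‖c - t‖ ≤ ρ →
      |remainderPart u x (c + t) + remainderPart u x (c - t) - 2 * remainderPart u x c|
        ≤ 2 * (2 * K * ρ ^ β) * ‖t‖ ^ 2 := by
  obtain ⟨b0, b1, b2⟩ := symmRemainder_bounds hu hK hβ h hρ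
  set r := reflectCoord 1
  have hr : ∀ ξ, ‖r ξ‖ = ‖ξ‖ := r.norm_map
  refine ⟨fun η hη => ?_, fun a b ha hb => ?_, fun c t hp hm => ?_⟩
  · have h1 := b0 η hη
    have h2 := b0 (r η) (by rwa [hr])
    refine (abs_add_le _ _).trans ?_
    linarith
  · have h1 := b1 a b ha hb
    have h2 := b1 (r a) (r b) (by rwa [hr]) (by rwa [hr])
    rw [← map_sub, hr] at h2
    rw [remainderPart, remainderPart, add_sub_add_comm]
    refine (abs_add_le _ _).trans ?_
    linarith
  · have h1 := b2 c t hp hm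
    have h2 := b2 (r c) (r t) (by rwa [← map_add, hr]) (by rwa [← map_sub, hr])
    rw [hr, ← map_add, ← map_sub] at h2
    rw [abs_le] at h1 h2 ⊢
    simp only [remainderPart]
    constructor <;> linarith [h1.1, h1.2, h2.1, h2.2]

theorem abs_remainderPart_div_le (hu : ContDiff ℝ 2 u) (hK : 0 ≤ K) {β : ℝ} (hβ : 0 ≤ β)
    (h : ∀ η, ‖hessianSymmDiff u x η‖ ≤ K * ‖η‖ ^ β) (ξ : Plane) :
    |remainderPart u x ξ / ‖ξ‖ ^ 2| ≤ 2 * K * ‖ξ‖ ^ β := by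
  have := (remainderPart_bounds hu hK hβ h (norm_nonneg ξ)).1 ξ le_rfl
  rw [abs_div, abs_of_nonneg (by positivity : 0 ≤ ‖ξ‖ ^ 2)]
  exact div_le_of_le_mul₀ (by positivity) (by positivity) this

theorem norm_bounds_of_mem_gridElement {h : ℝ} (hh : 0 < h) {i j : ℕ} (hij : ¬ (i = 0 ∧ j = 0))
    {ξ : Plane} (hξ : ξ ∈ gridElement h i j) :
    (max i j : ℕ) * h ≤ ‖ξ‖ ∧ ‖ξ‖ ≤ 3 * ((max i j : ℕ) * h) := by
  rw [mem_gridElement] at hξ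
  obtain ⟨⟨h1, h2⟩, h3, h4⟩ := hξ
  have hi0 : 0 ≤ (i : ℝ) * h := by positivity
  have hj0 : 0 ≤ (j : ℝ) * h := by positivity
  set m := max i j with hm
  have hm1 : (1 : ℝ) ≤ m := by exact_mod_cast (by omega : 1 ≤ m)
  have him : (i : ℝ) ≤ m := by exact_mod_cast le_max_left i j
  have hjm : (j : ℝ) ≤ m := by exact_mod_cast le_max_right i j
  constructor
  · rcases max_choice i j with H | H <;> rw [← hm] at H <;> rw [H]
    · exact h1.trans ((le_abs_self _).trans (Plane.abs_coord_le ξ 0))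
    · exact h3.trans ((le_abs_self _).trans (Plane.abs_coord_le ξ 1))
  -- Both coordinates are at most 2M with M = max(i, j)h, and 2√2 < 3.
  · have hmh : h ≤ m * h := le_mul_of_one_le_left hh.le hm1
    have u0 : ξ 0 ≤ 2 * (m * h) := by
      have : (i : ℝ) * h ≤ m * h := by gcongr
      linarith
    have u1 : ξ 1 ≤ 2 * (m * h) := by
      have : (j : ℝ) * h ≤ m * h := by gcongr
      linarith
    refine abs_le_of_sq_le_sq' ?_ (by positivity) |>.2
    rw [Plane.norm_sq]
    have v0 : ξ 0 ^ 2 ≤ (2 * (m * h)) ^ 2 := by gcongr; linarith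
    have v1 : ξ 1 ^ 2 ≤ (2 * (m * h)) ^ 2 := by gcongr; linarith
    nlinarith [sq_nonneg ((m : ℝ) * h)]

/-- On such a cell |ξ| is comparable to M = max(i, j)h. The two trapezoidal terms both scale as
M^{α+ε} · M^{-α} · M^{-2} = M^{ε-2}, which is then turned into a density in ξ. -/
theorem abs_cellError_remainder_le (hα0 : 0 < α) (hα2 : α < 2) (hε : 0 < ε) (hαε : α + ε ≤ 2)
    (hu : ContDiff ℝ 2 u) (hK : 0 ≤ K)
    (hH : ∀ η, ‖hessianSymmDiff u x η‖ ≤ K * ‖η‖ ^ (α + ε)) {h : ℝ} (hh : 0 < h) {i j : ℕ}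
    (hij : ¬ (i = 0 ∧ j = 0)) :
    |cellError α (fun ξ => remainderPart u x ξ / ‖ξ‖ ^ 2) h i j| ≤
      ∫ ξ in gridElement h i j, 150000 * K * h ^ 2 * ‖ξ‖ ^ (ε - 2) := by
  set M : ℝ := (max i j : ℕ) * h with hMdef
  have hM : 0 < M := by
    have : 0 < max i j := by omega
    have : (0 : ℝ) < (max i j : ℕ) := by exact_mod_cast this
    positivity
  have hb : ∀ ξ ∈ gridElement h i j, M ≤ ‖ξ‖ ∧ ‖ξ‖ ≤ 3 * M := fun ξ hξ =>
    norm_bounds_of_mem_gridElement hh hij hξ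
  set κ : ℝ := 2 * K * (3 * M) ^ (α + ε) with hκdef
  have hκ : 0 ≤ κ := by positivity
  obtain ⟨r0, r1, r2⟩ := remainderPart_bounds hu hK (by linarith : 0 ≤ α + ε) hH
    (by positivity : 0 ≤ 3 * M)
  obtain ⟨d1, d2⟩ := abs_div_norm_sq_diff_le hM hκ r0 r1 r2
  have hcI : cellCenter h i j ∈ gridElement h i j := cellCenter_mem hh.le i j
  refine abs_trapezoid_error_le (A := 57 * κ / M) (B := 686 * κ / M ^ 2)
    (W := α * M ^ (-α - 1)) (w := M ^ (-α)) hh hij (by positivity) (by positivity)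
    (fun a ha b hb' => d1 a b (hb a ha).1 (hb b hb').1 (hb a ha).2 (hb b hb').2)
    (fun a ha => ?_) (by positivity) (fun a ha b hb' => ?_) ?_ ?_ (fun ξ hξ => ?_)
  · have e1 : cellCenter h i j + (a - cellCenter h i j) = a := by abel
    have e2 : cellCenter h i j - (a - cellCenter h i j) = (2 : ℝ) • cellCenter h i j - a := by
      module
    have hr := hb _ (reflect_cellCenter_mem.2 ha)
    have := d2 (cellCenter h i j) (a - cellCenter h i j) (hb _ hcI).1
    rw [e1, e2] at this
    exact this (hb a ha).1 hr.1 (hb _ hcI).2 (hb a ha).2 hr.2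
  · rw [quadWeight_two, quadWeight_two]
    exact abs_norm_rpow_sub_le hα0 hM (hb a ha).1 (hb b hb').1
  · rw [quadWeight_two, abs_of_nonneg (by positivity)]
    exact Real.rpow_le_rpow_of_nonpos hM (hb _ hcI).1 (by linarith)
  · exact (integrableOn_norm_rpow_of_isBounded (by linarith)
      (isBounded_gridElement h i j)).const_mul _
  · obtain ⟨hξ1, hξ2⟩ := hb ξ hξ
    have hξ0 : 0 < ‖ξ‖ := hM.trans_le hξ1
    have p1 : M ^ (-α - 1) = M ^ (-α) / M := by rw [Real.rpow_sub hM, Real.rpow_one]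
    have p2 : κ * M ^ (-α) / M ^ 2 ≤ 18 * K * M ^ (ε - 2) := by
      have h3 : (3 : ℝ) ^ (α + ε) ≤ 9 := by
        calc (3 : ℝ) ^ (α + ε) ≤ 3 ^ (2 : ℝ) :=
              Real.rpow_le_rpow_of_exponent_le (by norm_num) hαε
          _ = 9 := by norm_num
      have e : M ^ (α + ε) * M ^ (-α) / M ^ 2 = M ^ (ε - 2) := by
        rw [← Real.rpow_natCast, ← Real.rpow_add hM, ← Real.rpow_sub hM]
        congr 1; push_cast; ring
      calc κ * M ^ (-α) / M ^ 2
          = 2 * K * 3 ^ (α + ε) * (M ^ (α + ε) * M ^ (-α) / M ^ 2) := by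
            rw [hκdef, Real.mul_rpow (by norm_num) hM.le]; ring
        _ ≤ 2 * K * 9 * M ^ (ε - 2) := by rw [e]; gcongr
        _ = _ := by ring
    -- From |ξ| ≤ 3M, the exponent ε - 2 being nonpositive and at least -2.
    have p3 : M ^ (ε - 2) ≤ 9 * ‖ξ‖ ^ (ε - 2) := by
      have h3 : (1 : ℝ) / 9 ≤ 3 ^ (ε - 2) := by
        calc (1 : ℝ) / 9 = 3 ^ (-2 : ℝ) := by rw [Real.rpow_neg (by norm_num)]; norm_num
          _ ≤ 3 ^ (ε - 2) := Real.rpow_le_rpow_of_exponent_le (by norm_num) (by linarith)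
      have h4 : (3 * M) ^ (ε - 2) ≤ ‖ξ‖ ^ (ε - 2) :=
        Real.rpow_le_rpow_of_nonpos hξ0 hξ2 (by linarith)
      rw [Real.mul_rpow (by norm_num) hM.le] at h4
      have h5 : 1 / 9 * M ^ (ε - 2) ≤ 3 ^ (ε - 2) * M ^ (ε - 2) := by gcongr
      linarith
    have hD : 0 ≤ κ * M ^ (-α) / M ^ 2 := by positivity
    have hX : 0 ≤ ‖ξ‖ ^ (ε - 2) := by positivity
    calc (2 * (57 * κ / M) * (α * M ^ (-α - 1)) + 686 * κ / M ^ 2 * M ^ (-α)) * h ^ 2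
        = (114 * α + 686) * (κ * M ^ (-α) / M ^ 2) * h ^ 2 := by
          rw [p1]; field_simp; ring
      _ ≤ (114 * 2 + 686) * (18 * K * (9 * ‖ξ‖ ^ (ε - 2))) * h ^ 2 := by
          gcongr
          exact p2.trans (by gcongr)
      _ = 148068 * (K * h ^ 2 * ‖ξ‖ ^ (ε - 2)) := by ring
      _ ≤ 150000 * (K * h ^ 2 * ‖ξ‖ ^ (ε - 2)) := by gcongr; norm_num
      _ = _ := by ring

theorem integrableOn_remainder_mul (hα2 : α < 2) (hu : ContDiff ℝ 2 u) (hK : 0 ≤ K) {β : ℝ}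
    (hβ : 0 ≤ β) (hH : ∀ η, ‖hessianSymmDiff u x η‖ ≤ K * ‖η‖ ^ β) (h : ℝ) (i j : ℕ) :
    IntegrableOn (fun ξ => remainderPart u x ξ / ‖ξ‖ ^ 2 * quadWeight 2 α ξ)
      (gridElement h i j) := by
  obtain ⟨R, -, hR⟩ := (isBounded_gridElement h i j).exists_pos_norm_le
  refine integrableOn_mul_quadWeight (B := 2 * K * R ^ β) hα2
    ((continuous_remainderPart hu x).measurable.div (measurable_norm.pow_const 2))
    (isBounded_gridElement h i j) (measurableSet_gridElement h i j) fun ξ hξ =>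
      (abs_remainderPart_div_le hu hK hβ hH ξ).trans ?_
  have := hR ξ hξ
  gcongr

theorem integrableOn_hessian_mul (hα2 : α < 2) (u : Plane → ℝ) (x : Plane) (h : ℝ) (i j : ℕ) :
    IntegrableOn (fun ξ => hessianPart u x ξ / ‖ξ‖ ^ 2 * quadWeight 2 α ξ)
      (gridElement h i j) := by
  refine integrableOn_mul_quadWeight (B := 2 * ‖fderiv ℝ (fderiv ℝ u) x‖) hα2
    ((continuous_hessianPart u x).measurable.div (measurable_norm.pow_const 2))
    (isBounded_gridElement h i j) (measurableSet_gridElement h i j) fun ξ _ => ?_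
  change |hessianPart u x ξ / ‖ξ‖ ^ 2| ≤ _
  rw [abs_div, abs_of_nonneg (by positivity : 0 ≤ ‖ξ‖ ^ 2)]
  exact div_le_of_le_mul₀ (by positivity) (by positivity) (abs_hessianPart_le u x ξ)

/-- No cancellation is needed next to the origin: the remainder quotient and its vertex average are
each O(h^{α+ε}) there, which is already small enough against the weight. -/
theorem abs_cellError_remainder_origin_le (hα2 : α < 2) (hα0 : 0 < α) (hε : 0 < ε)
    (hαε : α + ε ≤ 2) (hu : ContDiff ℝ 2 u) (hK : 0 ≤ K)
    (hH : ∀ η, ‖hessianSymmDiff u x η‖ ≤ K * ‖η‖ ^ (α + ε)) {h : ℝ} (hh : 0 < h) :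
    |cellError α (fun ξ => remainderPart u x ξ / ‖ξ‖ ^ 2) h 0 0| ≤
      ∫ ξ in gridElement h 0 0, 150000 * K * h ^ 2 * ‖ξ‖ ^ (ε - 2) := by
  have hβ : 0 ≤ α + ε := by linarith
  have hf := abs_remainderPart_div_le hu hK hβ hH
  set f : Plane → ℝ := fun ξ => remainderPart u x ξ / ‖ξ‖ ^ 2 with hfdef
  have hq : |vertexAvg f h 0 0| ≤ 2 * K * h ^ (α + ε) := by
    have n1 : ‖gridPoint h 1 0‖ = h := by
      have := Plane.norm_sq (gridPoint h 1 0)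
      rw [← sq_eq_sq₀ (norm_nonneg _) hh.le, this]
      simp [gridPoint]
    have n2 : ‖gridPoint h 0 1‖ = h := by
      rw [← swapCoord_gridPoint, LinearIsometryEquiv.norm_map, n1]
    have b1 : |f (gridPoint h 1 0)| ≤ _ := hf (gridPoint h 1 0)
    have b2 : |f (gridPoint h 0 1)| ≤ _ := hf (gridPoint h 0 1)
    rw [n1] at b1
    rw [n2] at b2
    rw [vertexAvg, if_pos ⟨rfl, rfl⟩]
    rw [abs_le] at b1 b2 ⊢
    constructor <;> linarith [b1.1, b1.2, b2.1, b2.2]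
  have hω : IntegrableOn (quadWeight 2 α) (gridElement h 0 0) :=
    integrableOn_norm_rpow_of_isBounded (by linarith) (isBounded_gridElement h 0 0)
  have hfω := integrableOn_remainder_mul hα2 hu hK hβ hH h 0 0
  rw [cellError, ← integral_const_mul, ← integral_sub (hω.const_mul _) hfω, ← Real.norm_eq_abs]
  refine norm_integral_le_of_norm_le ((integrableOn_norm_rpow_of_isBounded (by linarith)
      (isBounded_gridElement h 0 0)).const_mul _)
    ((ae_restrict_iff' (measurableSet_gridElement h 0 0)).2 (ae_of_all _ fun ξ hξ => ?_))
  rw [Real.norm_eq_abs, quadWeight_two]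
  rcases eq_or_ne ξ 0 with rfl | hne
  · rw [norm_zero, Real.zero_rpow (neg_ne_zero.2 hα0.ne')]
    simp only [mul_zero, sub_zero, abs_zero]
    positivity
  have hpos : 0 < ‖ξ‖ := norm_pos_iff.2 hne
  have hle : ‖ξ‖ ≤ 2 * h := by
    rw [mem_gridElement] at hξ
    obtain ⟨⟨h1, h2⟩, h3, h4⟩ := hξ
    simp only [Nat.cast_zero, zero_mul, zero_add, one_mul] at h1 h2 h3 h4
    have := Plane.norm_le ξ
    rw [abs_of_nonneg h1, abs_of_nonneg h3] at this
    linarith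
  have hX : 0 ≤ ‖ξ‖ ^ (ε - 2) := by positivity
  have s1 : ‖ξ‖ ^ (α + ε) * ‖ξ‖ ^ (-α) ≤ 4 * h ^ 2 * ‖ξ‖ ^ (ε - 2) := by
    have e : ‖ξ‖ ^ (α + ε) * ‖ξ‖ ^ (-α) = ‖ξ‖ ^ 2 * ‖ξ‖ ^ (ε - 2) := by
      rw [← Real.rpow_natCast, ← Real.rpow_add hpos, ← Real.rpow_add hpos]
      congr 1; push_cast; ring
    rw [e]
    gcongr
    calc ‖ξ‖ ^ 2 ≤ (2 * h) ^ 2 := by gcongr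
      _ = _ := by ring
  -- Both exponents α + ε and 2 - (α + ε) are nonnegative, so h and |ξ| can each be replaced by 2h.
  have s2 : h ^ (α + ε) * ‖ξ‖ ^ (-α) ≤ 4 * h ^ 2 * ‖ξ‖ ^ (ε - 2) := by
    have e : ‖ξ‖ ^ (-α) = ‖ξ‖ ^ (2 - (α + ε)) * ‖ξ‖ ^ (ε - 2) := by
      rw [← Real.rpow_add hpos]
      congr 1; ring
    rw [e, ← mul_assoc]
    refine mul_le_mul_of_nonneg_right ?_ hX
    calc h ^ (α + ε) * ‖ξ‖ ^ (2 - (α + ε)) ≤ (2 * h) ^ (α + ε) * (2 * h) ^ (2 - (α + ε)) := by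
          gcongr; all_goals linarith
      _ = (2 * h) ^ (2 : ℝ) := by rw [← Real.rpow_add (by positivity)]; congr 1; ring
      _ = 4 * h ^ 2 := by rw [Real.rpow_ofNat]; ring
  rw [← sub_mul, abs_mul, abs_of_nonneg (by positivity : 0 ≤ ‖ξ‖ ^ (-α))]
  have hqf : |vertexAvg f h 0 0 - f ξ| ≤ 2 * K * h ^ (α + ε) + 2 * K * ‖ξ‖ ^ (α + ε) :=
    (abs_sub _ _).trans (add_le_add hq (hf ξ))
  calc |vertexAvg f h 0 0 - f ξ| * ‖ξ‖ ^ (-α)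
      ≤ (2 * K * h ^ (α + ε) + 2 * K * ‖ξ‖ ^ (α + ε)) * ‖ξ‖ ^ (-α) := by gcongr
    _ = 2 * K * (h ^ (α + ε) * ‖ξ‖ ^ (-α)) + 2 * K * (‖ξ‖ ^ (α + ε) * ‖ξ‖ ^ (-α)) := by ring
    _ ≤ 2 * K * (4 * h ^ 2 * ‖ξ‖ ^ (ε - 2)) + 2 * K * (4 * h ^ 2 * ‖ξ‖ ^ (ε - 2)) := by gcongr
    _ = 16 * (K * h ^ 2 * ‖ξ‖ ^ (ε - 2)) := by ring
    _ ≤ 150000 * (K * h ^ 2 * ‖ξ‖ ^ (ε - 2)) := by gcongr; norm_num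
    _ = _ := by ring

/-- The total error of the weighted trapezoidal rule on the square `(0, N h)²`. -/
theorem abs_sum_cellError_le (hα0 : 0 < α) (hα2 : α < 2) (hε : 0 < ε) (hαε : α + ε ≤ 2)
    (hu : ContDiff ℝ 2 u) (hK : 0 ≤ K)
    (hH : ∀ η, ‖hessianSymmDiff u x η‖ ≤ K * ‖η‖ ^ (α + ε)) {h : ℝ} (hh : 0 < h) (N : ℕ) :
    |∑ i ∈ Finset.range N, ∑ j ∈ Finset.range N, cellError α (centralQuot 2 u x) h i j| ≤
      150000 * K * h ^ 2 * ∫ ξ in halfOpenSquare (N * h), ‖ξ‖ ^ (ε - 2) := by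
  have hβ : 0 ≤ α + ε := by linarith
  have hf : centralQuot 2 u x = fun ξ =>
      hessianPart u x ξ / ‖ξ‖ ^ 2 + remainderPart u x ξ / ‖ξ‖ ^ 2 := by
    ext ξ; rw [centralQuot_two_eq, fourPointDiff_eq, add_div]
  have hsplit : ∀ i j, cellError α (centralQuot 2 u x) h i j =
      cellError α (fun ξ => hessianPart u x ξ / ‖ξ‖ ^ 2) h i j +
      cellError α (fun ξ => remainderPart u x ξ / ‖ξ‖ ^ 2) h i j := fun i j => by
    rw [hf, cellError_add (integrableOn_hessian_mul hα2 u x h i j)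
      (integrableOn_remainder_mul hα2 hu hK hβ hH h i j)]
  obtain ⟨c, hc⟩ := hessianPart_add_swap u x
  have hzero := sum_cellError_eq_zero (α := α) (f := fun ξ => hessianPart u x ξ / ‖ξ‖ ^ 2) (c := c)
    hh (fun ξ hξ => by
      have : ‖ξ‖ ^ 2 ≠ 0 := pow_ne_zero 2 (norm_ne_zero_iff.2 hξ)
      rw [LinearIsometryEquiv.norm_map, ← add_div, hc, mul_div_cancel_right₀ _ this])
    (integrableOn_hessian_mul hα2 u x h) N
  simp only [hsplit, Finset.sum_add_distrib]
  rw [hzero, zero_add, ← integral_const_mul, ← sum_setIntegral_gridElement hh N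
    ((integrableOn_norm_rpow_of_isBounded (by linarith) (isBounded_halfOpenSquare _)).const_mul _)]
  refine (Finset.abs_sum_le_sum_abs _ _).trans (Finset.sum_le_sum fun i _ =>
    (Finset.abs_sum_le_sum_abs _ _).trans (Finset.sum_le_sum fun j _ => ?_))
  by_cases hij : i = 0 ∧ j = 0
  · obtain ⟨rfl, rfl⟩ := hij
    exact abs_cellError_remainder_origin_le hα2 hα0 hε hαε hu hK hH hh
  · exact abs_cellError_remainder_le hα0 hα2 hε hαε hu hK hH hh hij

end Remainder

/-! ### The far region and the assembly of the error bound -/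

theorem exists_bound_of_support_subset {a₁ b₁ a₂ b₂ : ℝ} {u : Plane → ℝ} (hu : Continuous u)
    (hsupp : Function.support u ⊆ rectDomain a₁ b₁ a₂ b₂) : ∃ M, ∀ x, |u x| ≤ M := by
  have hb : Bornology.IsBounded (rectDomain a₁ b₁ a₂ b₂) :=
    isBounded_of_coord_mem_Icc fun _ hξ => ⟨Ioo_subset_Icc_self hξ.1, Ioo_subset_Icc_self hξ.2⟩
  have hc : HasCompactSupport u :=
    HasCompactSupport.of_support_subset_isCompact hb.isCompact_closure
      (hsupp.trans subset_closure)
  exact hc.exists_bound_of_continuous hu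

/-- Some coordinate is displaced by at least L, which is no less than the width of Ω in that
direction, so all four shifted points lie outside Ω. -/
theorem fourPointDiff_of_mem_farRegion {a₁ b₁ a₂ b₂ : ℝ} {u : Plane → ℝ}
    (hsupp : Function.support u ⊆ rectDomain a₁ b₁ a₂ b₂) {x : Plane}
    (hx : x ∈ rectDomain a₁ b₁ a₂ b₂) {ξ : Plane}
    (hξ : ξ ∈ farRegion (max (b₁ - a₁) (b₂ - a₂))) : fourPointDiff u x ξ = -4 * u x := by
  have hz : ∀ y : Plane, y ∉ rectDomain a₁ b₁ a₂ b₂ → u y = 0 := fun y hy => by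
    by_contra hne; exact hy (hsupp hne)
  obtain ⟨hx0, hx1⟩ := hx
  obtain ⟨h0, h1, hL⟩ := hξ
  have l1 := le_max_left (b₁ - a₁) (b₂ - a₂)
  have l2 := le_max_right (b₁ - a₁) (b₂ - a₂)
  have key : ∀ s t : ℝ, (s = 1 ∨ s = -1) → (t = 1 ∨ t = -1) → ∀ y : Plane,
      y 0 = x 0 + s * ξ 0 → y 1 = x 1 + t * ξ 1 → u y = 0 := by
    intro s t hs ht y y0 y1
    refine hz y fun hy => ?_
    obtain ⟨⟨c1, c2⟩, c3, c4⟩ := hy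
    rw [y0] at c1 c2
    rw [y1] at c3 c4
    rcases hL with hL | hL
    · rcases hs with rfl | rfl <;> linarith [hx0.1, hx0.2]
    · rcases ht with rfl | rfl <;> linarith [hx1.1, hx1.2]
  rw [fourPointDiff, key 1 1 (by simp) (by simp) (x + ξ) (by simp) (by simp),
    key (-1) (-1) (by simp) (by simp) (x - ξ) (by simp [sub_eq_add_neg])
      (by simp [sub_eq_add_neg]),
    key 1 (-1) (by simp) (by simp) (x + reflectCoord 1 ξ) (by simp [reflectCoord_apply])
      (by simp [reflectCoord_apply]),
    key (-1) 1 (by simp) (by simp) (x - reflectCoord 1 ξ)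
      (by simp [reflectCoord_apply, sub_eq_add_neg]) (by simp [reflectCoord_apply])]
  ring

theorem fracLaplacian_sub_fracLaplacianFD {α a₁ b₁ a₂ b₂ : ℝ} (hα0 : 0 < α) (h₁ : a₁ < b₁)
    {u : Plane → ℝ} (hu : Continuous u)
    (hsupp : Function.support u ⊆ rectDomain a₁ b₁ a₂ b₂) {x : Plane}
    (hx : x ∈ rectDomain a₁ b₁ a₂ b₂) (hint : Integrable (symmIntegrand α u x)) {N : ℕ}
    (hN : 0 < N) :
    fracLaplacian α u x - fracLaplacianFD 2 α (max (b₁ - a₁) (b₂ - a₂)) N u x =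
      fracConst 2 α * ∑ i ∈ Finset.range N, ∑ j ∈ Finset.range N,
        cellError α (centralQuot 2 u x) (max (b₁ - a₁) (b₂ - a₂) / N) i j := by
  obtain ⟨M, hM⟩ := exists_bound_of_support_subset hu hsupp
  set L := max (b₁ - a₁) (b₂ - a₂) with hLdef
  have hL : 0 < L := lt_max_of_lt_left (by linarith)
  have hN' : (0 : ℝ) < N := by exact_mod_cast hN
  have hNh : (N : ℝ) * (L / N) = L := by field_simp
  have hfar : ∫ ξ in farRegion L, symmIntegrand α u x ξ =
      -4 * u x * ∫ ξ in farRegion L, ‖ξ‖ ^ (-(2 + α)) := by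
    rw [← integral_const_mul]
    refine setIntegral_congr_fun (measurableSet_farRegion L) fun ξ hξ => ?_
    simp only [symmIntegrand]
    rw [fourPointDiff_of_mem_farRegion hsupp hx hξ]
  have hnear : ∫ ξ in halfOpenSquare L, symmIntegrand α u x ξ =
      ∑ i ∈ Finset.range N, ∑ j ∈ Finset.range N,
        ∫ ξ in gridElement (L / N) i j, centralQuot 2 u x ξ * quadWeight 2 α ξ := by
    simp only [centralQuot_mul_quadWeight]
    rw [sum_setIntegral_gridElement (by positivity) N hint.integrableOn, hNh]
  rw [fracLaplacian_eq hα0 hu hM hint, setIntegral_firstQuadrant_eq (L := L) hint, hfar, hnear,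
    fracLaplacianFD]
  simp only [elementQuad_two_eq, cellError, Finset.sum_sub_distrib]
  ring

theorem theorem2 (α ε a₁ b₁ a₂ b₂ : ℝ) (hα0 : 0 < α) (hα2 : α < 2)
    (h₁ : a₁ < b₁) (h₂ : a₂ < b₂)
    (hε0 : 0 < ε) (hε1 : ε ≤ 1 + (⌊α⌋₊ : ℝ) - α)
    (u : EuclideanSpace ℝ (Fin 2) → ℝ)
    (hsupp : Function.support u ⊆ rectDomain a₁ b₁ a₂ b₂)
    (hu : IsHolderClass (2 + ⌊α⌋₊) (α - (⌊α⌋₊ : ℝ) + ε) u) :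
    (∀ x ∈ rectDomain a₁ b₁ a₂ b₂, FracLaplacianExists α u x) ∧
    ∃ C : ℝ, 0 < C ∧ ∀ N : ℕ, 0 < N → ∀ x ∈ rectDomain a₁ b₁ a₂ b₂,
      |fracLaplacian α u x - fracLaplacianFD 2 α (max (b₁ - a₁) (b₂ - a₂)) N u x| ≤
        C * (max (b₁ - a₁) (b₂ - a₂) / N) ^ 2 := by
  obtain ⟨hc, K, hK, hH⟩ := hu.exists_hessianSymmDiff_le hα0 hα2 hε0
  -- The upper bound on ε gives α + ε ≤ 1 + ⌊α⌋, and ⌊α⌋ ≤ 1.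
  have hαε : α + ε ≤ 2 := by
    have : ⌊α⌋₊ < 2 := (Nat.floor_lt hα0.le).2 (by exact_mod_cast hα2)
    have : (⌊α⌋₊ : ℝ) ≤ 1 := by exact_mod_cast Nat.lt_succ_iff.1 this
    linarith
  have hβ : 0 ≤ α + ε := by linarith
  obtain ⟨M, hM⟩ := exists_bound_of_support_subset hc.continuous hsupp
  have hint : ∀ x, Integrable (symmIntegrand α u x) := fun x => by
    refine integrable_symmIntegrand hα0 hα2 hc.continuous hM
      (C := 2 * ‖fderiv ℝ (fderiv ℝ u) x‖ + 2 * K) fun ξ hξ => ?_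
    have hr := (remainderPart_bounds hc hK hβ (hH x) (norm_nonneg ξ)).1 ξ le_rfl
    have h1 : ‖ξ‖ ^ (α + ε) ≤ 1 := Real.rpow_le_one (norm_nonneg ξ) hξ hβ
    rw [fourPointDiff_eq, add_mul]
    refine (abs_add_le _ _).trans (add_le_add (abs_hessianPart_le u x ξ) (hr.trans ?_))
    refine mul_le_mul_of_nonneg_right ?_ (by positivity)
    exact mul_le_of_le_one_right (by positivity) h1
  refine ⟨fun x _ => fracLaplacianExists_of_integrable hα0 hc.continuous hM (hint x), ?_⟩
  set L := max (b₁ - a₁) (b₂ - a₂) with hLdef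
  have hL : 0 < L := lt_max_of_lt_left (by linarith)
  set J := ∫ ξ in halfOpenSquare L, ‖ξ‖ ^ (ε - 2) with hJ
  have hJ0 : 0 ≤ J := integral_nonneg fun ξ => by positivity
  -- Neither `K` nor `J` depends on x or N; the summand 1 only secures a positive constant.
  refine ⟨|fracConst 2 α| * (150000 * K * J) + 1, by positivity, fun N hN x hx => ?_⟩
  have hN' : (0 : ℝ) < N := by exact_mod_cast hN
  have hNh : (N : ℝ) * (L / N) = L := by field_simp
  have hsum := abs_sum_cellError_le hα0 hα2 hε0 hαε hc hK (hH x) (h := L / N) (by positivity) N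
  rw [hNh, ← hJ] at hsum
  rw [fracLaplacian_sub_fracLaplacianFD hα0 h₁ hc.continuous hsupp hx (hint x) hN, abs_mul]
  calc _ ≤ |fracConst 2 α| * (150000 * K * (L / N) ^ 2 * J) := by gcongr
    _ ≤ |fracConst 2 α| * (150000 * K * (L / N) ^ 2 * J) + (L / N) ^ 2 :=
      le_add_of_nonneg_right (by positivity)
    _ = _ := by ring

end
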